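/- For an integer $N \ge 1$ let $\mathcal C_N$ be the set of all genus-$2$ curves $C : y^2 = F(x,z) = f_6x^6 + f_5x^5z + \dots + f_1xz^5 + f_0z^6$ with $f_j \in \mathbb Z$ and $|f_j| \le N$ for all $j$ (so $F$ is a form without repeated factors), considered in the weighted projective plane with weights $1,3,1$ for $x,y,z$; each curve is identified with its form $F$. For $(a:b) \in \mathbb P^1(\mathbb Q)$, written with coprime integers $a,b$, let $H(a:b) = \max\{|a|,|b|\}$ and let $\mathbb E_{(a:b)}(N)$ be the average over $C \in \mathcal C_N$ of the number of rational points on $C$ with $x$-coordinate $(x:z) = (a:b)$. Let $\phi(0) = 1$ and, for $t > 0$, \[ \phi(t) = \frac{1}{3\cdot 5\cdot 7\cdot 9\cdot 11\cdot 13\, t^{21}} \sum_{\varepsilon_0,\dots,\varepsilon_6 \in \{\pm 1\}} \varepsilon_0\varepsilon_1\cdots\varepsilon_6 \, \max\{\varepsilon_0 + \varepsilon_1 t + \dots + \varepsilon_6 t^6,\, 0\}^{13/2}, \] and put $\gamma(a:b) = |b|^{-3}\,\phi(|a|/|b|)$ if $b \neq 0$, and $\gamma(1:0) = 1$. Then,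 with $H = H(a:b)$, \[ \mathbb E_{(a:b)}(N) = \frac{\gamma(a:b)}{\sqrt N} + O\bigl(H^{-6}N^{-1}\bigr) + O\bigl(H^{-2}N^{-3/2}\bigr) + O\bigl(H^{3}N^{-13/2}\bigr) \] for all $N \ge 1$ and all $(a:b) \in \mathbb P^1(\mathbb Q)$, with absolute implied constants. In particular, $\sqrt N\,\mathbb E_{(a:b)}(N) \to \gamma(a:b)$ as $N \to \infty$, uniformly for $(a:b)$ with $H(a:b) \ll N^{2-\varepsilon}$; that is, for every $\varepsilon > 0$ and every $K$, the convergence is uniform over all $(a:b)$ with $H(a:b) \le K N^{2-\varepsilon}$. -/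

import Mathlib

open scoped LinearAlgebra.Projectivization

noncomputable section

namespace GenusTwo

/-- The value `F(x, z) = f₆ x⁶ + f₅ x⁵ z + ⋯ + f₁ x z⁵ + f₀ z⁶` of the binary sextic form with
integral coefficients `f`. -/
def formEval (f : Fin 7 → ℤ) (x z : ℚ) : ℚ :=
  ∑ j : Fin 7, (f j : ℚ) * x ^ (j : ℕ) * z ^ (6 - (j : ℕ))

/-- The same binary sextic form as a polynomial in two variables over `ℚ`. -/
def formPoly (f : Fin 7 → ℤ) : MvPolynomial (Fin 2) ℚ :=
  ∑ j : Fin 7, MvPolynomial.C (f j : ℚ) * MvPolynomial.X 0 ^ (j : ℕ)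
    * MvPolynomial.X 1 ^ (6 - (j : ℕ))

/-- The curve `y² = F(x, z)` in the weighted projective plane with weights `1, 3, 1` is smooth,
equivalently has genus two, if and only if the form `F` has no repeated factor.  (Over the perfect
field `ℚ` this does not change when passing to an algebraic closure.) -/
def IsGenusTwo (f : Fin 7 → ℤ) : Prop := Squarefree (formPoly f)

/-- The triples `(x, y, z) ≠ 0` of rational numbers with `y² = F(x, z)`. -/
def Cone (f : Fin 7 → ℤ) : Type :=
  {v : ℚ × ℚ × ℚ // v ≠ 0 ∧ v.2.1 ^ 2 = formEval f v.1 v.2.2}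

/-- Two triples define the same point of the weighted projective plane if they differ by
`(x, y, z) ↦ (c x, c³ y, c z)` with `c ≠ 0`. -/
def coneSetoid (f : Fin 7 → ℤ) : Setoid (Cone f) where
  r v w := ∃ c : ℚ, c ≠ 0 ∧ w.1 = (c * v.1.1, c ^ 3 * v.1.2.1, c * v.1.2.2)
  iseqv :=
    { refl := fun v => ⟨1, one_ne_zero, by simp⟩
      symm := by
        rintro v w ⟨c, hc, h⟩
        refine ⟨c⁻¹, inv_ne_zero hc, ?_⟩
        rw [h]
        ext <;> simp [hc]
      trans := by
        rintro u v w ⟨c, hc, h⟩ ⟨d, hd, h'⟩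
        refine ⟨d * c, mul_ne_zero hd hc, ?_⟩
        rw [h', h]
        ext <;> simp <;> ring }

/-- The set `C(ℚ)` of rational points of the curve `C : y² = F(x, z)`. -/
def RatPoint (f : Fin 7 → ℤ) : Type := Quotient (coneSetoid f)

theorem Cone.xz_ne_zero {f : Fin 7 → ℤ} (v : Cone f) : ![v.1.1, v.1.2.2] ≠ 0 := by
  intro h
  have hx : v.1.1 = 0 := by simpa using congrFun h 0
  have hz : v.1.2.2 = 0 := by simpa using congrFun h 1
  have hy : v.1.2.1 = 0 := by
    have h2 := v.2.2
    rw [hx, hz] at h2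
    simpa [formEval, Fin.sum_univ_succ] using h2
  exact v.2.1 (Prod.ext hx (Prod.ext hy hz))

/-- The `x`-coordinate `(x : z) ∈ ℙ¹(ℚ)` of a rational point `(x : y : z)`. -/
def RatPoint.xCoord {f : Fin 7 → ℤ} (P : RatPoint f) : ℙ ℚ (Fin 2 → ℚ) :=
  Quotient.lift (s := coneSetoid f)
    (fun v : Cone f => Projectivization.mk ℚ ![v.1.1, v.1.2.2] v.xz_ne_zero)
    (by
      rintro v w ⟨c, hc, h⟩
      refine ((Projectivization.mk_eq_mk_iff' ℚ _ _ _ _).2 ⟨c, ?_⟩).symm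
      rw [h]
      ext i
      fin_cases i <;> simp) P

/-- The point `(a : b) ∈ ℙ¹(ℚ)` given by coprime integers. -/
def pt (a b : ℤ) (h : IsCoprime a b) : ℙ ℚ (Fin 2 → ℚ) :=
  Projectivization.mk ℚ ![(a : ℚ), (b : ℚ)] (by
    intro h0
    have ha : a = 0 := by simpa using congrFun h0 0
    have hb : b = 0 := by simpa using congrFun h0 1
    subst ha hb
    exact not_isCoprime_zero_zero h)

open Classical in
/-- The set `𝒞_N` of genus two curves `y² = F(x, z)` with `|f_j| ≤ N` for all `j`, each curve being
identified with its coefficient vector. -/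
def curves (N : ℕ) : Finset (Fin 7 → ℤ) :=
  (Fintype.piFinset fun _ => Finset.Icc (-(N : ℤ)) N).filter IsGenusTwo

/-- The average over the curves in `𝒞_N` of the number of rational points with `x`-coordinate
`Q`. -/
def avgPoints (Q : ℙ ℚ (Fin 2 → ℚ)) (N : ℕ) : ℝ :=
  (∑ f ∈ curves N, (Nat.card {P : RatPoint f // P.xCoord = Q} : ℝ)) / ((curves N).card : ℝ)

/-- The height of `(a : b)` for coprime integers `a`, `b`. -/
def height (a b : ℤ) : ℝ := max |(a : ℝ)| |(b : ℝ)|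

/-- The function `φ` on `t ≥ 0`: `φ(0) = 1`, and for `t > 0` the signed sum over all
`(ε₀, …, ε₆) ∈ {±1}⁷`. -/
def phi (t : ℝ) : ℝ :=
  if t = 0 then 1
  else 1 / (3 * 5 * 7 * 9 * 11 * 13 * t ^ 21) *
    ∑ ε : Fin 7 → ℤˣ, (∏ i, ((ε i : ℤ) : ℝ)) *
      (max (∑ i : Fin 7, ((ε i : ℤ) : ℝ) * t ^ (i : ℕ)) 0) ^ (13 / 2 : ℝ)

/-- `γ(a : b) = |b|⁻³ φ(|a| / |b|)` for `b ≠ 0`, and `γ(1 : 0) = γ(0 : 1) = 1`. -/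
def gamma (a b : ℤ) : ℝ :=
  if b = 0 then 1 else 1 / |(b : ℝ)| ^ 3 * phi (|(a : ℝ)| / |(b : ℝ)|)

end GenusTwo

end

namespace GenusTwo

open MeasureTheory Set

/-- The variation of `φ` is controlled by a monotone function with values in `[0, B]`. -/
def VarBound (φ : ℝ → ℝ) (B : ℝ) : Prop :=
  ∃ w : ℝ → ℝ, (∀ x, 0 ≤ w x ∧ w x ≤ B) ∧ ∀ x y, x ≤ y → |φ y - φ x| ≤ w y - w x

theorem VarBound.intervalIntegrable {φ : ℝ → ℝ} {B : ℝ} (h : VarBound φ B) (x y : ℝ) :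
    IntervalIntegrable φ volume x y := by
  obtain ⟨w, -, hw⟩ := h
  have h1 : Monotone w := fun s t hst => by
    have := (abs_nonneg _).trans (hw s t hst)
    linarith
  have h2 : Monotone (fun s => φ s + w s) := fun s t hst => by
    have := (abs_le.1 (hw s t hst)).1
    simp only
    linarith
  have h3 := (h2.intervalIntegrable (a := x) (b := y) (μ := volume)).sub
    (h1.intervalIntegrable (a := x) (b := y))
  simpa [Pi.sub_def] using h3

theorem VarBound.comp_affine {φ : ℝ → ℝ} {B : ℝ} (h : VarBound φ B) (r c : ℝ) :
    VarBound (fun u => φ (r + c * u)) B := by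
  obtain ⟨w, hB, hw⟩ := h
  rcases le_total 0 c with hc | hc
  · exact ⟨fun u => w (r + c * u), fun x => hB _, fun x y hxy => hw _ _ (by nlinarith)⟩
  · refine ⟨fun u => B - w (r + c * u), fun x => ⟨by linarith [(hB (r + c * x)).2],
      by linarith [(hB (r + c * x)).1]⟩, fun x y hxy => ?_⟩
    have := hw (r + c * y) (r + c * x) (by nlinarith)
    rw [abs_sub_comm] at this
    linarith

theorem VarBound.abs_sum_Ico_sub_integral_le {φ : ℝ → ℝ} {B : ℝ} (h : VarBound φ B) {p q : ℤ}
    (hpq : p ≤ q) : |∑ n ∈ Finset.Ico p q, φ n - ∫ s in (p : ℝ)..q, φ s| ≤ B := by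
  have hint := h.intervalIntegrable
  obtain ⟨w, hB, hw⟩ := h
  suffices H : |∑ n ∈ Finset.Ico p q, φ n - ∫ s in (p : ℝ)..q, φ s| ≤ w q - w p by
    linarith [(hB q).2, (hB p).1]
  induction q, hpq using Int.leInduction with
  | base => simp
  | succ q hpq ih =>
    have h1 : ∑ n ∈ Finset.Ico p (q + 1), φ n = ∑ n ∈ Finset.Ico p q, φ n + φ q := by
      rw [← Finset.insert_Ico_right_eq_Ico_add_one hpq, Finset.sum_insert (by simp), add_comm]
    have h2 : ∫ s in (p : ℝ)..((q + 1 : ℤ) : ℝ), φ s =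
        (∫ s in (p : ℝ)..q, φ s) + ∫ s in (q : ℝ)..((q + 1 : ℤ) : ℝ), φ s :=
      (intervalIntegral.integral_add_adjacent_intervals (hint _ _) (hint _ _)).symm
    have h3 : |∫ s in (q : ℝ)..((q + 1 : ℤ) : ℝ), (φ s - φ q)| ≤
        (w ((q + 1 : ℤ) : ℝ) - w q) * |((q + 1 : ℤ) : ℝ) - q| := by
      rw [← Real.norm_eq_abs]
      refine intervalIntegral.norm_integral_le_of_norm_le_const fun s hs => ?_
      rw [uIoc_of_le (by push_cast; linarith)] at hs
      have a1 := hw q s hs.1.le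
      have a2 := (abs_nonneg _).trans (hw s _ hs.2)
      rw [Real.norm_eq_abs]
      linarith
    rw [intervalIntegral.integral_sub (hint _ _) (by simp)] at h3
    simp only [intervalIntegral.integral_const, smul_eq_mul] at h3
    have h4 : ((q + 1 : ℤ) : ℝ) - q = 1 := by push_cast; ring
    rw [h4, abs_one, mul_one, one_mul] at h3
    rw [h1, h2]
    rw [abs_le] at h3 ih ⊢
    constructor <;> linarith [h3.1, h3.2, ih.1, ih.2]

theorem VarBound.abs_sum_Icc_sub_integral_le {φ : ℝ → ℝ} {B M : ℝ} (h : VarBound φ B)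
    (hM : ∀ s, 0 ≤ φ s ∧ φ s ≤ M) {x y : ℝ} (hxy : x ≤ y) :
    |∑ n ∈ Finset.Icc ⌈x⌉ ⌊y⌋, φ n - ∫ s in x..y, φ s| ≤ B + 3 * M := by
  have hint := h.intervalIntegrable
  have hM0 : 0 ≤ M := (hM 0).1.trans (hM 0).2
  have hB0 : 0 ≤ B := by
    obtain ⟨w, hB, -⟩ := h
    exact (hB 0).1.trans (hB 0).2
  have hI : ∀ s t : ℝ, s ≤ t → t ≤ s + 1 → |∫ v in s..t, φ v| ≤ M := fun s t hst hts => by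
    rw [← Real.norm_eq_abs]
    refine (intervalIntegral.norm_integral_le_of_norm_le_const (C := M) fun v _ => ?_).trans ?_
    · rw [Real.norm_eq_abs, abs_of_nonneg (hM v).1]
      exact (hM v).2
    · rw [abs_of_nonneg (by linarith)]
      nlinarith
  rcases le_or_gt ⌈x⌉ ⌊y⌋ with hpq | hpq
  · have h0 := h.abs_sum_Ico_sub_integral_le hpq
    have h1 : ∑ n ∈ Finset.Icc ⌈x⌉ ⌊y⌋, φ n = ∑ n ∈ Finset.Ico ⌈x⌉ ⌊y⌋, φ n + φ ⌊y⌋ := by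
      rw [← Finset.Ico_insert_right hpq, Finset.sum_insert (by simp), add_comm]
    have h2 : ∫ s in x..y, φ s = (∫ s in x..⌈x⌉, φ s) + (∫ s in (⌈x⌉ : ℝ)..⌊y⌋, φ s) +
        ∫ s in (⌊y⌋ : ℝ)..y, φ s := by
      rw [intervalIntegral.integral_add_adjacent_intervals (hint _ _) (hint _ _),
        intervalIntegral.integral_add_adjacent_intervals (hint _ _) (hint _ _)]
    have h3 := hI x ⌈x⌉ (Int.le_ceil x) (Int.ceil_lt_add_one x).le
    have h4 := hI ⌊y⌋ y (Int.floor_le y) (Int.lt_floor_add_one y).le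
    have h5 := hM ⌊y⌋
    rw [h1, h2]
    rw [abs_le] at h0 h3 h4 ⊢
    constructor <;> linarith [h0.1, h0.2, h3.1, h3.2, h4.1, h4.2, h5.1, h5.2]
  · have h1 : (⌊y⌋ : ℝ) + 1 ≤ ⌈x⌉ := by exact_mod_cast hpq
    have h2 := hI x y hxy (by linarith [Int.lt_floor_add_one y, Int.ceil_lt_add_one x])
    rw [Finset.Icc_eq_empty (by omega), Finset.sum_empty, zero_sub, abs_neg]
    linarith

/-- Nonnegative functions of a real variable that are even and decrease away from the origin. -/
structure SymmDecr (g : ℝ → ℝ) : Prop where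
  nonneg : ∀ s, 0 ≤ g s
  le : ∀ s t, |s| ≤ |t| → g t ≤ g s

theorem integral_comp_neg_symm (f : ℝ → ℝ) (N : ℝ) :
    ∫ u in (-N)..N, f (-u) = ∫ u in (-N)..N, f u := by
  rw [intervalIntegral.integral_comp_neg, neg_neg]

namespace SymmDecr

variable {g : ℝ → ℝ}

theorem le_zero (h : SymmDecr g) (s : ℝ) : g s ≤ g 0 := h.le 0 s (by simp)

theorem neg (h : SymmDecr g) (s : ℝ) : g (-s) = g s :=
  le_antisymm (h.le _ _ (by simp)) (h.le _ _ (by simp))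

theorem varBound (h : SymmDecr g) : VarBound g (2 * g 0) := by
  refine ⟨fun x => if x ≤ 0 then g x else 2 * g 0 - g x, fun x => ?_, fun x y hxy => ?_⟩
  · have h1 := h.le_zero x
    have h2 := h.nonneg x
    have h3 := h.nonneg 0
    dsimp only
    split_ifs <;> constructor <;> linarith
  · have h1 := h.le_zero x
    have h2 := h.le_zero y
    dsimp only
    split_ifs with hy hx hx
    · rw [abs_of_nonneg]
      exact sub_nonneg.2 (h.le _ _ (by rw [abs_of_nonpos hx, abs_of_nonpos hy]; linarith))
    · linarith
    · rw [abs_le]; constructor <;> linarith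
    · have := h.le x y (by rw [abs_of_nonneg (by linarith), abs_of_nonneg (by linarith)]; exact hxy)
      rw [abs_of_nonpos (by linarith)]
      linarith

theorem measurable (h : SymmDecr g) : Measurable g := by
  have h1 : Antitone fun s => g (max s 0) := fun s t hst => h.le _ _ (by
    rw [abs_of_nonneg (le_max_right _ _), abs_of_nonneg (le_max_right _ _)]
    exact max_le_max_right 0 hst)
  have h2 : g = (fun s => g (max s 0)) ∘ fun s => |s| := by
    funext s
    simp only [Function.comp_apply, max_eq_left (abs_nonneg s)]
    exact le_antisymm (h.le _ _ (by simp)) (h.le _ _ (by simp))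
  rw [h2]
  exact h1.measurable.comp measurable_abs

theorem comp_mul (h : SymmDecr g) (c : ℝ) : SymmDecr fun s => g (c * s) :=
  ⟨fun s => h.nonneg _, fun s t hst => h.le _ _ (by
    rw [abs_mul, abs_mul]; exact mul_le_mul_of_nonneg_left hst (abs_nonneg c))⟩

theorem comp_sq (h : SymmDecr g) : SymmDecr fun s => g (s ^ 2) :=
  ⟨fun s => h.nonneg _, fun s t hst => h.le _ _ (by
    rw [abs_pow, abs_pow]; exact pow_le_pow_left₀ (abs_nonneg s) hst 2)⟩

theorem intervalIntegrable_affine (h : SymmDecr g) (r c x y : ℝ) :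
    IntervalIntegrable (fun u => g (r + c * u)) volume x y :=
  (h.varBound.comp_affine r c).intervalIntegrable x y

/-- Averaging a symmetric decreasing function over a symmetric interval. -/
theorem integral_shift (h : SymmDecr g) (c : ℝ) {N : ℝ} (hN : 0 ≤ N) :
    SymmDecr fun s => ∫ u in (-N)..N, g (s + c * u) := by
  have hint := h.varBound.intervalIntegrable
  have hneg : ∀ s, (∫ u in (-N)..N, g (-s + c * u)) = ∫ u in (-N)..N, g (s + c * u) := fun s => by
    rw [← integral_comp_neg_symm]
    refine intervalIntegral.integral_congr fun u _ => ?_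
    rw [← h.neg]
    congr 1; ring
  have hpos : ∀ c : ℝ, 0 < c → ∀ s t : ℝ, 0 ≤ s → s ≤ t →
      (∫ u in (-N)..N, g (t + c * u)) ≤ ∫ u in (-N)..N, g (s + c * u) := fun c hc s t hs hst => by
    rw [intervalIntegral.integral_comp_add_mul _ hc.ne', intervalIntegral.integral_comp_add_mul _ hc.ne',
      smul_eq_mul, smul_eq_mul]
    refine mul_le_mul_of_nonneg_left ?_ (inv_nonneg.2 hc.le)
    have e1 := intervalIntegral.integral_add_adjacent_intervals
      (hint (s + c * -N) (t + c * -N)) (hint (t + c * -N) (t + c * N))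
    have e2 := intervalIntegral.integral_add_adjacent_intervals
      (hint (s + c * -N) (s + c * N)) (hint (s + c * N) (t + c * N))
    have e3 : (∫ v in (s + c * N)..(t + c * N), g v) ≤ ∫ v in (s + c * -N)..(t + c * -N), g v := by
      rw [← intervalIntegral.integral_comp_add_right, ← intervalIntegral.integral_comp_add_right]
      refine intervalIntegral.integral_mono_on hst ?_ ?_ fun v hv => h.le _ _ ?_
      · simpa [add_comm] using h.intervalIntegrable_affine (c * N) 1 s t
      · simpa [add_comm] using h.intervalIntegrable_affine (c * -N) 1 s t
      · have : 0 ≤ c * N := by positivity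
        have hv0 : 0 ≤ v := hs.trans hv.1
        rw [abs_of_nonneg (by linarith : 0 ≤ v + c * N), abs_le]
        constructor <;> linarith
    linarith
  have hpos' : ∀ s t : ℝ, 0 ≤ s → s ≤ t →
      (∫ u in (-N)..N, g (t + c * u)) ≤ ∫ u in (-N)..N, g (s + c * u) := fun s t hs hst => by
    rcases lt_trichotomy c 0 with hc | hc | hc
    · have := hpos (-c) (by linarith) s t hs hst
      rw [← integral_comp_neg_symm, ← integral_comp_neg_symm (fun u => g (s + -c * u))] at this
      simpa using this
    · subst hc
      simp only [zero_mul, add_zero, intervalIntegral.integral_const, smul_eq_mul]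
      refine mul_le_mul_of_nonneg_left (h.le _ _ ?_) (by linarith)
      rwa [abs_of_nonneg hs, abs_of_nonneg (hs.trans hst)]
    · exact hpos c hc s t hs hst
  have habs : ∀ s, (∫ u in (-N)..N, g (|s| + c * u)) = ∫ u in (-N)..N, g (s + c * u) := fun s => by
    rcases abs_choice s with hs | hs <;> rw [hs]
    exact hneg s
  refine ⟨fun s => intervalIntegral.integral_nonneg (by linarith) fun u _ => h.nonneg _,
    fun s t hst => ?_⟩
  rw [← habs s, ← habs t]
  exact hpos' _ _ (abs_nonneg s) hst

end SymmDecr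

/-- The density of the slice `∑ uⱼ aʲ bᵏ⁻ʲ = s` of the cube `[-N, N] ^ (k + 1)`. -/
noncomputable def sliceVol (a b N : ℝ) : ℕ → ℝ → ℝ
  | 0 => fun s => if |s| ≤ N then 1 else 0
  | k + 1 => fun s => b⁻¹ * ∫ u in (-N)..N, sliceVol a b N k (b⁻¹ * s + -(b⁻¹ * a ^ (k + 1)) * u)

section

variable {a b N : ℝ}

theorem sliceVol_symmDecr (hb : 0 < b) (hN : 0 ≤ N) (k : ℕ) : SymmDecr (sliceVol a b N k) := by
  induction k with
  | zero =>
    refine ⟨fun s => ?_, fun s t hst => ?_⟩ <;> simp only [sliceVol] <;> split_ifs <;> grind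
  | succ k ih =>
    have h := (ih.integral_shift (-(b⁻¹ * a ^ (k + 1))) hN).comp_mul b⁻¹
    have hb' : 0 ≤ b⁻¹ := inv_nonneg.2 hb.le
    exact ⟨fun s => mul_nonneg hb' (h.nonneg s),
      fun s t hst => mul_le_mul_of_nonneg_left (h.le s t hst) hb'⟩

theorem sliceVol_zero_le (hb : 0 < b) (hN : 0 ≤ N) (k : ℕ) :
    sliceVol a b N k 0 ≤ (2 * (N / b)) ^ k := by
  induction k with
  | zero => simp only [sliceVol, pow_zero]; split_ifs <;> norm_num
  | succ k ih =>
    have hg := sliceVol_symmDecr (a := a) hb hN k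
    have h1 : (∫ u in (-N)..N, sliceVol a b N k (b⁻¹ * 0 + -(b⁻¹ * a ^ (k + 1)) * u)) ≤
        ∫ _ in (-N)..N, (2 * (N / b)) ^ k :=
      intervalIntegral.integral_mono_on (by linarith) (hg.intervalIntegrable_affine _ _ _ _)
        (by simp) fun u _ => (hg.le_zero _).trans ih
    rw [intervalIntegral.integral_const, smul_eq_mul] at h1
    calc sliceVol a b N (k + 1) 0 ≤ b⁻¹ * ((N - -N) * (2 * (N / b)) ^ k) :=
          mul_le_mul_of_nonneg_left h1 (inv_nonneg.2 hb.le)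
      _ = _ := by rw [pow_succ, div_eq_mul_inv]; ring

theorem sliceVol_le (hb : 0 < b) (hN : 0 ≤ N) (k : ℕ) (s : ℝ) :
    sliceVol a b N k s ≤ (2 * (N / b)) ^ k :=
  ((sliceVol_symmDecr hb hN k).le_zero s).trans (sliceVol_zero_le hb hN k)

theorem sliceVol_eq_zero (hb : 0 < b) (hN : 0 ≤ N) (hab : |a| ≤ b) (k : ℕ) (s : ℝ)
    (hs : (k + 1) * N * b ^ k < |s|) : sliceVol a b N k s = 0 := by
  induction k generalizing s with
  | zero => simp only [sliceVol]; rw [if_neg]; simpa using hs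
  | succ k ih =>
    simp only [sliceVol]
    rw [intervalIntegral.integral_congr (g := fun _ => (0 : ℝ)), intervalIntegral.integral_zero,
      mul_zero]
    intro u hu
    rw [uIcc_of_le (by linarith)] at hu
    apply ih
    have h1 : |a ^ (k + 1) * u| ≤ b ^ (k + 1) * N := by
      rw [abs_mul, abs_pow]
      exact mul_le_mul (pow_le_pow_left₀ (abs_nonneg a) hab _) (abs_le.2 hu) (abs_nonneg u)
        (by positivity)
    have h2 : b⁻¹ * s + -(b⁻¹ * a ^ (k + 1)) * u = b⁻¹ * (s - a ^ (k + 1) * u) := by ring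
    rw [h2, abs_mul, abs_inv, abs_of_pos hb, lt_inv_mul_iff₀ hb]
    have h3 := abs_sub_abs_le_abs_sub s (a ^ (k + 1) * u)
    push_cast at hs
    calc b * ((k + 1) * N * b ^ k) = (k + 1 + 1) * N * b ^ (k + 1) - b ^ (k + 1) * N := by ring
      _ < _ := by linarith

theorem sliceVol_neg (k : ℕ) (s : ℝ) : sliceVol (-a) b N k s = sliceVol a b N k s := by
  induction k generalizing s with
  | zero => rfl
  | succ k ih =>
    simp only [sliceVol, ih]
    congr 1
    rcases Nat.even_or_odd (k + 1) with h | h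
    · rw [h.neg_pow]
    · rw [h.neg_pow, ← integral_comp_neg_symm]
      refine intervalIntegral.integral_congr fun u _ => ?_
      congr 1; ring

theorem sliceVol_abs (k : ℕ) (s : ℝ) : sliceVol |a| b N k s = sliceVol a b N k s := by
  rcases abs_choice a with h | h <;> rw [h]
  exact sliceVol_neg k s

end

/-- The integral vectors in the cube `[-N, N] ^ k`. -/
noncomputable def box (k N : ℕ) : Finset (Fin k → ℤ) := Fintype.piFinset fun _ => Finset.Icc (-(N : ℤ)) N

theorem mem_box {k N : ℕ} {f : Fin k → ℤ} : f ∈ box k N ↔ ∀ i, -(N : ℤ) ≤ f i ∧ f i ≤ N := by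
  simp [box, Fintype.mem_piFinset]

/-- The value at `(a, b)` of the binary form of degree `k` with coefficients `f`. -/
def homEval (a b : ℤ) (k : ℕ) (f : Fin (k + 1) → ℤ) : ℤ :=
  ∑ j : Fin (k + 1), f j * a ^ (j : ℕ) * b ^ (k - (j : ℕ))

theorem homEval_snoc (a b : ℤ) (k : ℕ) (f : Fin (k + 1) → ℤ) (u : ℤ) :
    homEval a b (k + 1) (Fin.snoc f u) = b * homEval a b k f + u * a ^ (k + 1) := by
  unfold homEval
  rw [Fin.sum_univ_castSucc, Finset.mul_sum]
  congr 1
  · refine Finset.sum_congr rfl fun j _ => ?_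
    have : k + 1 - (j : ℕ) = k - j + 1 := by omega
    simp only [Fin.snoc_castSucc, Fin.val_castSucc, this]
    ring
  · simp

theorem card_filter_box_succ (k N : ℕ) (p : (Fin (k + 1) → ℤ) → Prop) [DecidablePred p] :
    ((box (k + 1) N).filter p).card = ∑ u ∈ Finset.Icc (-(N : ℤ)) N,
      ((box k N).filter fun f => p (Fin.snoc f u)).card := by
  classical
  rw [Finset.card_eq_sum_card_fiberwise (f := fun f : Fin (k + 1) → ℤ => f (Fin.last k))
    (t := Finset.Icc (-(N : ℤ)) N)]
  · refine Finset.sum_congr rfl fun u hu => ?_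
    refine Finset.card_bij' (fun f _ => Fin.init f) (fun f _ => Fin.snoc f u) ?_ ?_ ?_ ?_
    · intro f hf
      simp only [Finset.mem_filter, mem_box] at hf ⊢
      refine ⟨fun i => hf.1.1 _, ?_⟩
      rw [← hf.2, Fin.snoc_init_self]
      exact hf.1.2
    · intro f hf
      simp only [Finset.mem_filter, mem_box, Finset.mem_Icc] at hf hu ⊢
      refine ⟨⟨fun i => ?_, hf.2⟩, by simp⟩
      refine Fin.lastCases ?_ (fun i => ?_) i
      · simpa using hu
      · simpa using hf.1 i
    · intro f hf
      simp only [Finset.mem_filter] at hf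
      rw [← hf.2, Fin.snoc_init_self]
    · intro f hf
      simp
  · intro f hf
    simp only [Finset.coe_filter, mem_box, mem_ofPred_eq] at hf
    simpa using hf.1 (Fin.last k)

/-- The number of binary forms of degree `k` with coefficients in `[-N, N]` taking the value `m`
at `(a, b)`. -/
noncomputable def sliceCard (a b : ℤ) (N k : ℕ) (m : ℤ) : ℕ :=
  ((box (k + 1) N).filter fun f => homEval a b k f = m).card

theorem sliceCard_zero (a b : ℤ) (N : ℕ) (m : ℤ) :
    sliceCard a b N 0 m = if |m| ≤ N then 1 else 0 := by
  have h : ∀ f : Fin 1 → ℤ, homEval a b 0 f = f 0 := fun f => by simp [homEval]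
  simp only [sliceCard, h]
  split_ifs with hm
  · rw [Finset.card_eq_one]
    refine ⟨fun _ => m, ?_⟩
    ext f
    simp only [Finset.mem_filter, mem_box, Finset.mem_singleton]
    constructor
    · rintro ⟨-, rfl⟩
      funext i
      rw [show i = 0 by omega]
    · rintro rfl
      exact ⟨fun _ => abs_le.1 hm, rfl⟩
  · rw [Finset.card_eq_zero, Finset.filter_eq_empty_iff]
    rintro f hf rfl
    exact hm (abs_le.2 (mem_box.1 hf 0))

theorem sliceCard_succ {a b : ℤ} (hb : 0 < b) (N k : ℕ) (m : ℤ) :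
    sliceCard a b N (k + 1) m = ∑ u ∈ (Finset.Icc (-(N : ℤ)) N).filter
      (fun u => b ∣ m - u * a ^ (k + 1)), sliceCard a b N k ((m - u * a ^ (k + 1)) / b) := by
  rw [sliceCard, card_filter_box_succ, Finset.sum_filter]
  refine Finset.sum_congr rfl fun u _ => ?_
  simp only [homEval_snoc]
  split_ifs with h
  · unfold sliceCard
    congr 1
    refine Finset.filter_congr fun f _ => ?_
    rw [← eq_sub_iff_add_eq, eq_comm (b := m - _), eq_comm (b := _ / b),
      Int.ediv_eq_iff_eq_mul_right hb.ne' h]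
  · rw [Finset.card_eq_zero, Finset.filter_eq_empty_iff]
    rintro f - rfl
    exact h ⟨homEval a b k f, by ring⟩

/-- A sum over a residue class in `[-N, N]`. -/
theorem sum_residue_class {b c m : ℤ} (hb : 0 < b) (hc : IsCoprime c b) (N : ℕ) :
    ∃ r : ℤ, (∀ u, b ∣ m - u * c ↔ b ∣ u - r) ∧
    ∀ F : ℤ → ℝ, ∑ u ∈ (Finset.Icc (-(N : ℤ)) N).filter (fun u => b ∣ m - u * c), F u =
      ∑ n ∈ Finset.Icc ⌈(-(N : ℝ) - r) / b⌉ ⌊((N : ℝ) - r) / b⌋, F (r + b * n) := by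
  obtain ⟨s, t, hst⟩ := hc
  have hr : ∀ u, b ∣ m - u * c ↔ b ∣ u - s * m := fun u => by
    constructor
    · rintro ⟨q, hq⟩
      exact ⟨t * u - s * q, by linear_combination (-u) * hst - s * hq⟩
    · rintro ⟨q, hq⟩
      exact ⟨t * m - q * c, by linear_combination (-m) * hst - c * hq⟩
  refine ⟨s * m, hr, fun F => ?_⟩
  have hbR : (0 : ℝ) < b := by exact_mod_cast hb
  symm
  refine Finset.sum_bij' (fun n _ => s * m + b * n) (fun u _ => (u - s * m) / b) ?_ ?_ ?_ ?_ ?_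
  · intro n hn
    rw [Finset.mem_Icc, Int.ceil_le, Int.le_floor, div_le_iff₀ hbR, le_div_iff₀ hbR] at hn
    rw [Finset.mem_filter, Finset.mem_Icc, hr]
    refine ⟨⟨?_, ?_⟩, ⟨n, by ring⟩⟩
    · have : (-(N : ℝ)) ≤ (s * m : ℤ) + b * n := by linarith [hn.1]
      exact_mod_cast this
    · have : ((s * m : ℤ) : ℝ) + b * n ≤ N := by linarith [hn.2]
      exact_mod_cast this
  · intro u hu
    rw [Finset.mem_filter, Finset.mem_Icc, hr] at hu
    obtain ⟨⟨h1, h2⟩, q, hq⟩ := hu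
    rw [hq, Int.mul_ediv_cancel_left _ hb.ne']
    rw [Finset.mem_Icc, Int.ceil_le, Int.le_floor, div_le_iff₀ hbR, le_div_iff₀ hbR]
    have h1' : (-(N : ℝ)) ≤ u := by exact_mod_cast h1
    have h2' : (u : ℝ) ≤ N := by exact_mod_cast h2
    have hq' : (u : ℝ) - (s * m : ℤ) = b * q := by exact_mod_cast hq
    constructor <;> linarith
  · intro n _
    simp [hb.ne']
  · intro u hu
    rw [Finset.mem_filter, hr] at hu
    rw [Int.mul_ediv_cancel' hu.2]
    ring
  · intro n _
    rfl

theorem card_residue_class_le {b c m : ℤ} (hb : 0 < b) (hc : IsCoprime c b) (N : ℕ) :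
    (((Finset.Icc (-(N : ℤ)) N).filter fun u => b ∣ m - u * c).card : ℝ) ≤
      2 * ((N : ℝ) / b) + 1 := by
  obtain ⟨r, -, h⟩ := sum_residue_class (m := m) hb hc N
  have h1 := h fun _ => 1
  simp only [Finset.sum_const, nsmul_eq_mul, mul_one, Int.card_Icc] at h1
  rw [h1]
  have hbR : (0 : ℝ) < b := by exact_mod_cast hb
  have h2 := Int.le_ceil ((-(N : ℝ) - r) / b)
  have h3 := Int.floor_le (((N : ℝ) - r) / b)
  have h4 : ((N : ℝ) - r) / b - (-(N : ℝ) - r) / b = 2 * ((N : ℝ) / b) := by ring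
  have h5 : 0 ≤ (N : ℝ) / b := by positivity
  rcases le_total 0 (⌊((N : ℝ) - r) / b⌋ + 1 - ⌈(-(N : ℝ) - r) / b⌉) with h0 | h0
  · have : ((⌊((N : ℝ) - r) / b⌋ + 1 - ⌈(-(N : ℝ) - r) / b⌉).toNat : ℝ) =
      ((⌊((N : ℝ) - r) / b⌋ + 1 - ⌈(-(N : ℝ) - r) / b⌉ : ℤ) : ℝ) := by
      exact_mod_cast Int.toNat_of_nonneg h0
    rw [this]
    push_cast
    linarith
  · rw [Int.toNat_of_nonpos h0]
    push_cast
    linarith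

/-- Comparison of the sum of a symmetric decreasing function over a residue class with the
corresponding integral. -/
theorem abs_sum_residue_class_sub_integral_le {g : ℝ → ℝ} (hg : SymmDecr g) {b c m : ℤ}
    (hb : 0 < b) (hc : IsCoprime c b) (N : ℕ) (x y : ℝ) :
    |∑ u ∈ (Finset.Icc (-(N : ℤ)) N).filter (fun u => b ∣ m - u * c), g (x + y * u) -
      (b : ℝ)⁻¹ * ∫ u in (-(N : ℝ))..N, g (x + y * u)| ≤ 5 * g 0 := by
  obtain ⟨r, -, h⟩ := sum_residue_class (m := m) hb hc N
  have hbR : (0 : ℝ) < b := by exact_mod_cast hb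
  rw [h fun u => g (x + y * u)]
  have h1 := ((hg.varBound.comp_affine x y).comp_affine r b).abs_sum_Icc_sub_integral_le
    (M := g 0) (fun s => ⟨hg.nonneg _, hg.le_zero _⟩)
    (x := (-(N : ℝ) - r) / b) (y := ((N : ℝ) - r) / b) (by gcongr; linarith)
  rw [intervalIntegral.integral_comp_add_mul (fun u => g (x + y * u)) hbR.ne'] at h1
  have e1 : (r : ℝ) + b * ((-(N : ℝ) - r) / b) = -N := by field_simp; ring
  have e2 : (r : ℝ) + b * (((N : ℝ) - r) / b) = N := by field_simp; ring
  rw [e1, e2, smul_eq_mul] at h1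
  push_cast
  linarith

theorem abs_sliceCard_sub_sliceVol_le (k : ℕ) : ∃ C : ℝ, 0 ≤ C ∧ ∀ (a b : ℤ), IsCoprime a b →
    0 < b → ∀ (N : ℕ) (m : ℤ), |(sliceCard a b N k m : ℝ) - sliceVol a b N k m| *
      ((N : ℝ) / b + 1) ≤ C * ((N : ℝ) / b + 1) ^ k := by
  induction k with
  | zero =>
    refine ⟨0, le_rfl, fun a b _ _ N m => ?_⟩
    have : ((sliceCard a b N 0 m : ℕ) : ℝ) = sliceVol a b N 0 m := by
      rw [sliceCard_zero]
      simp only [sliceVol]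
      have : (|(m : ℝ)| ≤ N) ↔ |m| ≤ N := by rw [← Int.cast_abs]; norm_cast
      simp only [this]
      split_ifs <;> simp
    rw [this]
    simp
  | succ k ih =>
    obtain ⟨C, hC, ih⟩ := ih
    refine ⟨2 * C + 5 * 2 ^ k, by positivity, fun a b hab hb N m => ?_⟩
    have hbR : (0 : ℝ) < b := by exact_mod_cast hb
    set x : ℝ := (N : ℝ) / b with hx
    have hx0 : 0 ≤ x := by positivity
    have hg := sliceVol_symmDecr (a := a) hbR (Nat.cast_nonneg N) k
    have hcop : IsCoprime (a ^ (k + 1)) b := hab.pow_left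
    set U := (Finset.Icc (-(N : ℤ)) N).filter fun u => b ∣ m - u * a ^ (k + 1) with hU
    have h1 := abs_sum_residue_class_sub_integral_le (m := m) hg hb hcop N
      ((b : ℝ)⁻¹ * m) (-((b : ℝ)⁻¹ * (a : ℝ) ^ (k + 1)))
    rw [← hU] at h1
    have h2 : |(sliceCard a b N (k + 1) m : ℝ) -
        ∑ u ∈ U, sliceVol a b N k ((b : ℝ)⁻¹ * m + -((b : ℝ)⁻¹ * (a : ℝ) ^ (k + 1)) * u)| *
        (x + 1) ≤ (2 * x + 1) * (C * (x + 1) ^ k) := by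
      rw [sliceCard_succ hb, ← hU, Nat.cast_sum, ← Finset.sum_sub_distrib]
      calc _ ≤ (∑ u ∈ U, |(sliceCard a b N k ((m - u * a ^ (k + 1)) / b) : ℝ) -
            sliceVol a b N k ((b : ℝ)⁻¹ * m + -((b : ℝ)⁻¹ * (a : ℝ) ^ (k + 1)) * u)|) * (x + 1) :=
            mul_le_mul_of_nonneg_right (Finset.abs_sum_le_sum_abs _ _) (by positivity)
        _ = ∑ u ∈ U, |(sliceCard a b N k ((m - u * a ^ (k + 1)) / b) : ℝ) -
            sliceVol a b N k ((b : ℝ)⁻¹ * m + -((b : ℝ)⁻¹ * (a : ℝ) ^ (k + 1)) * u)| * (x + 1) :=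
            Finset.sum_mul _ _ _
        _ ≤ ∑ u ∈ U, C * (x + 1) ^ k := by
            refine Finset.sum_le_sum fun u hu => ?_
            have hd : b ∣ m - u * a ^ (k + 1) := (Finset.mem_filter.1 hu).2
            have e : (b : ℝ)⁻¹ * m + -((b : ℝ)⁻¹ * (a : ℝ) ^ (k + 1)) * u =
                (((m - u * a ^ (k + 1)) / b : ℤ) : ℝ) := by
              rw [Int.cast_div hd hbR.ne']
              push_cast
              field_simp
              ring
            rw [e]
            exact ih a b hab hb N _
        _ = U.card * (C * (x + 1) ^ k) := by rw [Finset.sum_const, nsmul_eq_mul]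
        _ ≤ _ := mul_le_mul_of_nonneg_right (card_residue_class_le hb hcop N) (by positivity)
    have h3 : (5 : ℝ) * sliceVol a b N k 0 ≤ 5 * 2 ^ k * (x + 1) ^ k := by
      have := sliceVol_zero_le (a := a) hbR (Nat.cast_nonneg N) k
      rw [mul_pow, ← hx] at this
      have h4 : x ^ k ≤ (x + 1) ^ k := pow_le_pow_left₀ hx0 (by linarith) k
      have h5 : (2 : ℝ) ^ k * x ^ k ≤ 2 ^ k * (x + 1) ^ k :=
        mul_le_mul_of_nonneg_left h4 (by positivity)
      linarith
    have h4 := (abs_sub_le (sliceCard a b N (k + 1) m : ℝ) _ (sliceVol a b N (k + 1) m)).trans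
      (add_le_add_right (h1.trans h3) _)
    have hp : 0 ≤ (x + 1) ^ k := by positivity
    calc _ ≤ _ := mul_le_mul_of_nonneg_right h4 (by positivity)
      _ ≤ (2 * x + 1) * (C * (x + 1) ^ k) + 5 * 2 ^ k * (x + 1) ^ k * (x + 1) := by
          rw [add_mul]; linarith
      _ ≤ (2 * C + 5 * 2 ^ k) * (x + 1) ^ (k + 1) := by
          rw [pow_succ]
          nlinarith [mul_nonneg hC hp]

theorem sliceCard_le (k : ℕ) : ∃ C : ℝ, 0 ≤ C ∧ ∀ (a b : ℤ), IsCoprime a b →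
    0 < b → ∀ (N : ℕ) (m : ℤ), (sliceCard a b N k m : ℝ) ≤ C * ((N : ℝ) / b + 1) ^ k := by
  obtain ⟨C, hC, h⟩ := abs_sliceCard_sub_sliceVol_le k
  refine ⟨C + 2 ^ k, by positivity, fun a b hab hb N m => ?_⟩
  have hbR : (0 : ℝ) < b := by exact_mod_cast hb
  have h1 := h a b hab hb N m
  have h2 := sliceVol_le (a := a) hbR (Nat.cast_nonneg N) k m
  set x : ℝ := (N : ℝ) / b with hx
  have hx0 : 0 ≤ x := by positivity
  have h4 : x ^ k ≤ (x + 1) ^ k := pow_le_pow_left₀ hx0 (by linarith) k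
  have h5 : (2 : ℝ) ^ k * x ^ k ≤ 2 ^ k * (x + 1) ^ k :=
    mul_le_mul_of_nonneg_left h4 (by positivity)
  rw [mul_pow] at h2
  have h6 := le_mul_of_one_le_right (abs_nonneg ((sliceCard a b N k m : ℝ) - sliceVol a b N k m))
    (by linarith : (1 : ℝ) ≤ x + 1)
  have h7 := le_abs_self ((sliceCard a b N k m : ℝ) - sliceVol a b N k m)
  linarith

/-- The number of vectors in a cube lying in a hyperplane modulo `b ^ k`. -/
theorem card_filter_dvd_le (a b : ℤ) (hab : IsCoprime a b) (hb : 0 < b) (N e k : ℕ) (m : ℤ) :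
    (((box k N).filter fun f => b ^ k ∣
      m - ∑ j : Fin k, f j * a ^ (e + (j : ℕ)) * b ^ (k - 1 - (j : ℕ))).card : ℝ) ≤
      (2 * ((N : ℝ) / b) + 1) ^ k := by
  induction k generalizing m with
  | zero =>
    simp only [pow_zero]
    exact_mod_cast (Finset.card_filter_le _ _).trans (by simp [box])
  | succ k ih =>
    have hbR : (0 : ℝ) < b := by exact_mod_cast hb
    have hcop : IsCoprime (a ^ (e + k)) b := hab.pow_left
    rw [card_filter_box_succ, Nat.cast_sum]
    have key : ∀ (f : Fin k → ℤ) (u : ℤ), m - ∑ j : Fin (k + 1),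
        (Fin.snoc f u : Fin (k + 1) → ℤ) j * a ^ (e + (j : ℕ)) * b ^ (k + 1 - 1 - (j : ℕ)) =
        m - u * a ^ (e + k) - b * ∑ j : Fin k, f j * a ^ (e + (j : ℕ)) * b ^ (k - 1 - (j : ℕ)) := by
      intro f u
      rw [Fin.sum_univ_castSucc, Finset.mul_sum]
      have : ∑ j : Fin k, (Fin.snoc f u : Fin (k + 1) → ℤ) j.castSucc *
          a ^ (e + ((j.castSucc : Fin (k + 1)) : ℕ)) * b ^ (k + 1 - 1 - ((j.castSucc : Fin (k + 1)) : ℕ)) =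
          ∑ j : Fin k, b * (f j * a ^ (e + (j : ℕ)) * b ^ (k - 1 - (j : ℕ))) := by
        refine Finset.sum_congr rfl fun j _ => ?_
        have hj : k + 1 - 1 - (j : ℕ) = k - 1 - j + 1 := by omega
        simp only [Fin.snoc_castSucc, Fin.val_castSucc, hj]
        ring
      rw [this]
      simp only [Fin.snoc_last, Fin.val_last, Nat.add_sub_cancel, Nat.sub_self, pow_zero, mul_one]
      ring
    simp only [key]
    rw [← Finset.sum_filter_add_sum_filter_not _ (fun u => b ∣ m - u * a ^ (e + k))]
    have h0 : ∑ u ∈ (Finset.Icc (-(N : ℤ)) N).filter (fun u => ¬ b ∣ m - u * a ^ (e + k)),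
        (((box k N).filter fun f => b ^ (k + 1) ∣ m - u * a ^ (e + k) -
          b * ∑ j : Fin k, f j * a ^ (e + (j : ℕ)) * b ^ (k - 1 - (j : ℕ))).card : ℝ) = 0 := by
      refine Finset.sum_eq_zero fun u hu => ?_
      rw [Nat.cast_eq_zero, Finset.card_eq_zero, Finset.filter_eq_empty_iff]
      intro f _ hd
      refine (Finset.mem_filter.1 hu).2 ?_
      have := (dvd_pow_self b (Nat.succ_ne_zero k)).trans hd
      exact (dvd_sub_left (dvd_mul_right _ _)).1 this
    rw [h0, add_zero]
    calc _ ≤ ∑ u ∈ (Finset.Icc (-(N : ℤ)) N).filter (fun u => b ∣ m - u * a ^ (e + k)),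
          (2 * ((N : ℝ) / b) + 1) ^ k := by
          refine Finset.sum_le_sum fun u hu => ?_
          obtain ⟨q, hq⟩ := (Finset.mem_filter.1 hu).2
          refine le_trans (le_of_eq ?_) (ih q)
          congr 2
          refine Finset.filter_congr fun f _ => ?_
          rw [hq, ← mul_sub, pow_succ', Int.mul_dvd_mul_iff_left hb.ne']
      _ ≤ _ := by
          rw [Finset.sum_const, nsmul_eq_mul, pow_succ']
          exact mul_le_mul_of_nonneg_right (card_residue_class_le hb hcop N) (by positivity)

/-- The shape of the error terms, multiplied by `N ^ 7`. -/
noncomputable def errBound (b : ℤ) (N : ℕ) : ℝ :=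
  ((N : ℝ) / b) ^ 6 + √(N : ℝ) * (b : ℝ) ^ 3 * (((N : ℝ) / b) ^ 5 + 1)

/-- The range for the `y`-coordinate. -/
noncomputable def yRange (b : ℤ) (N : ℕ) : Finset ℤ :=
  Finset.Icc ⌈-(3 * √(N : ℝ) * (b : ℝ) ^ 3)⌉ ⌊3 * √(N : ℝ) * (b : ℝ) ^ 3⌋

theorem one_le_sqrt_mul {b : ℤ} (hb : 0 < b) {N : ℕ} (hN : 1 ≤ N) :
    1 ≤ √(N : ℝ) * (b : ℝ) ^ 3 := by
  have h1 : (1 : ℝ) ≤ √(N : ℝ) := Real.one_le_sqrt.2 (by exact_mod_cast hN)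
  have h2 : (1 : ℝ) ≤ b := by exact_mod_cast hb
  exact one_le_mul_of_one_le_of_one_le h1 (one_le_pow₀ h2)

theorem card_yRange_le {b : ℤ} (hb : 0 < b) {N : ℕ} (hN : 1 ≤ N) :
    ((yRange b N).card : ℝ) ≤ 7 * (√(N : ℝ) * (b : ℝ) ^ 3) := by
  have h := one_le_sqrt_mul hb hN
  set R := √(N : ℝ) * (b : ℝ) ^ 3 with hR
  have e : 3 * √(N : ℝ) * (b : ℝ) ^ 3 = 3 * R := by rw [hR]; ring
  rw [yRange, e, Int.card_Icc]
  have h1 := Int.le_ceil (-(3 * R))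
  have h2 := Int.floor_le (3 * R)
  have h3 : 0 ≤ ⌊3 * R⌋ + 1 - ⌈-(3 * R)⌉ := by
    rw [Int.ceil_neg]
    have := Int.floor_nonneg.2 (by linarith : 0 ≤ 3 * R)
    omega
  have : ((⌊3 * R⌋ + 1 - ⌈-(3 * R)⌉).toNat : ℝ) = ((⌊3 * R⌋ + 1 - ⌈-(3 * R)⌉ : ℤ) : ℝ) := by
    exact_mod_cast Int.toNat_of_nonneg h3
  rw [this]
  push_cast
  linarith

theorem add_one_pow_five_le {x : ℝ} (hx : 0 ≤ x) : (x + 1) ^ 5 ≤ 32 * (x ^ 5 + 1) := by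
  rcases le_total x 1 with h | h
  · calc (x + 1) ^ 5 ≤ 2 ^ 5 := pow_le_pow_left₀ (by linarith) (by linarith) 5
      _ ≤ _ := by have := pow_nonneg hx 5; linarith
  · calc (x + 1) ^ 5 ≤ (2 * x) ^ 5 := pow_le_pow_left₀ (by linarith) (by linarith) 5
      _ ≤ _ := by rw [mul_pow]; linarith

theorem sum_yRange_le {b : ℤ} (hb : 0 < b) {N : ℕ} (hN : 1 ≤ N) {C : ℝ} (hC : 0 ≤ C) {F : ℤ → ℝ}
    {S : Finset ℤ} (hS : S ⊆ yRange b N) (hF : ∀ y ∈ S, F y ≤ C * ((N : ℝ) / b + 1) ^ 5) :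
    ∑ y ∈ S, F y ≤ 224 * C * errBound b N := by
  have hbR : (0 : ℝ) < b := by exact_mod_cast hb
  have h1 := card_yRange_le hb hN
  have h2 : (0 : ℝ) ≤ (N : ℝ) / b := by positivity
  have h3 := add_one_pow_five_le h2
  have h4 : ((S.card : ℕ) : ℝ) ≤ (yRange b N).card := by exact_mod_cast Finset.card_le_card hS
  unfold errBound
  calc ∑ y ∈ S, F y ≤ S.card * (C * ((N : ℝ) / b + 1) ^ 5) := by
        rw [← nsmul_eq_mul]; exact Finset.sum_le_card_nsmul _ _ _ hF
    _ ≤ 7 * (√(N : ℝ) * (b : ℝ) ^ 3) * (C * (32 * (((N : ℝ) / b) ^ 5 + 1))) := by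
        gcongr
        linarith
    _ = 224 * C * (√(N : ℝ) * (b : ℝ) ^ 3 * (((N : ℝ) / b) ^ 5 + 1)) := by ring
    _ ≤ _ := by
        have : 0 ≤ 224 * C * ((N : ℝ) / b) ^ 6 := by positivity
        rw [mul_add]
        linarith

theorem abs_sum_sliceCard_sub_integral_le : ∃ C : ℝ, 0 ≤ C ∧ ∀ (a b : ℤ), IsCoprime a b →
    0 < b → ∀ N : ℕ, 1 ≤ N → |∑ y ∈ yRange b N, (sliceCard a b N 6 (y ^ 2) : ℝ) -
      ∫ y in (-(3 * √(N : ℝ) * (b : ℝ) ^ 3))..(3 * √(N : ℝ) * (b : ℝ) ^ 3),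
        sliceVol a b N 6 (y ^ 2)| ≤ C * errBound b N := by
  obtain ⟨C, hC, h⟩ := abs_sliceCard_sub_sliceVol_le 6
  refine ⟨224 * C + 320, by positivity, fun a b hab hb N hN => ?_⟩
  have hbR : (0 : ℝ) < b := by exact_mod_cast hb
  have hg := (sliceVol_symmDecr (a := a) hbR (Nat.cast_nonneg N) 6).comp_sq
  have hR := one_le_sqrt_mul hb hN
  have h1 := hg.varBound.abs_sum_Icc_sub_integral_le (M := sliceVol a b N 6 (0 ^ 2))
    (fun s => ⟨hg.nonneg s, hg.le_zero s⟩)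
    (x := -(3 * √(N : ℝ) * (b : ℝ) ^ 3)) (y := 3 * √(N : ℝ) * (b : ℝ) ^ 3) (by linarith)
  have h2 := sliceVol_le (a := a) hbR (Nat.cast_nonneg N) 6 (0 ^ 2)
  have h3 : |∑ y ∈ yRange b N, (sliceCard a b N 6 (y ^ 2) : ℝ) -
      ∑ y ∈ yRange b N, sliceVol a b N 6 ((y : ℝ) ^ 2)| ≤ 224 * C * errBound b N := by
    rw [← Finset.sum_sub_distrib]
    refine (Finset.abs_sum_le_sum_abs _ _).trans
      (sum_yRange_le hb hN hC (Finset.Subset.refl _) fun y _ => ?_)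
    have h4 := h a b hab hb N (y ^ 2)
    have h5 : (0 : ℝ) < (N : ℝ) / b + 1 := by positivity
    rw [pow_succ ((N : ℝ) / b + 1) 5, ← mul_assoc] at h4
    have := le_of_mul_le_mul_right h4 h5
    push_cast at this
    exact this
  have h4 : ((N : ℝ) / b) ^ 6 ≤ errBound b N := by
    unfold errBound
    have : 0 ≤ √(N : ℝ) * (b : ℝ) ^ 3 * (((N : ℝ) / b) ^ 5 + 1) := by positivity
    linarith
  rw [mul_pow] at h2
  have h5 := (abs_sub_le _ _ _).trans (add_le_add h3 h1)
  refine h5.trans ?_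
  norm_num at h2 ⊢
  linarith

/-- The truncated power `s ↦ s₊ ^ p`. -/
noncomputable def posPow (p s : ℝ) : ℝ := max s 0 ^ p

theorem posPow_of_nonpos {p s : ℝ} (hp : p ≠ 0) (hs : s ≤ 0) : posPow p s = 0 := by
  rw [posPow, max_eq_right hs, Real.zero_rpow hp]

theorem posPow_of_nonneg {p s : ℝ} (hs : 0 ≤ s) : posPow p s = s ^ p := by
  rw [posPow, max_eq_left hs]

theorem posPow_mul {p c : ℝ} (hc : 0 ≤ c) (s : ℝ) : posPow p (c * s) = c ^ p * posPow p s := by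
  rw [posPow, posPow, ← Real.mul_rpow hc (le_max_right _ _), mul_max_of_nonneg _ _ hc, mul_zero]

theorem posPow_eq_indicator {p : ℝ} (hp : p ≠ 0) :
    posPow p = (Ioi (0 : ℝ)).indicator fun s => s ^ p := by
  funext s
  by_cases hs : 0 < s
  · rw [indicator_of_mem (mem_Ioi.2 hs), posPow_of_nonneg hs.le]
  · rw [indicator_of_notMem (by simpa using hs), posPow_of_nonpos hp (not_lt.1 hs)]

theorem intervalIntegrable_posPow {p : ℝ} (hp : -1 < p) (hp0 : p ≠ 0) (x y : ℝ) :
    IntervalIntegrable (posPow p) volume x y := by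
  rw [posPow_eq_indicator hp0]
  have h := intervalIntegral.intervalIntegrable_rpow' hp (a := x) (b := y)
  exact ⟨h.1.indicator measurableSet_Ioi, h.2.indicator measurableSet_Ioi⟩

theorem integral_posPow {p : ℝ} (hp : -1 < p) (hp0 : p ≠ 0) (x y : ℝ) :
    ∫ s in x..y, posPow p s = (posPow (p + 1) y - posPow (p + 1) x) / (p + 1) := by
  have hp1 : 0 < p + 1 := by linarith
  have hc : Continuous fun s => posPow (p + 1) s / (p + 1) := by
    unfold posPow
    exact ((Real.continuous_rpow_const hp1.le).comp (continuous_id.max continuous_const)).div_const _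
  rw [sub_div]
  refine integral_eq_of_hasDerivAt_off_countable (fun s => posPow (p + 1) s / (p + 1)) _
    (s := {0}) (countable_singleton _) hc.continuousOn (fun s hs => ?_)
    (intervalIntegrable_posPow hp hp0 x y)
  have hs0 : s ≠ 0 := hs.2
  rcases lt_or_gt_of_ne hs0 with h | h
  · rw [posPow_of_nonpos hp0 h.le]
    refine (hasDerivAt_const s (0 : ℝ)).congr_of_eventuallyEq ?_
    filter_upwards [eventually_lt_nhds h] with v hv
    rw [posPow_of_nonpos hp1.ne' hv.le, zero_div]
  · rw [posPow_of_nonneg h.le]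
    have := (Real.hasDerivAt_rpow_const (p := p + 1) (Or.inl hs0)).div_const (p + 1)
    rw [add_sub_cancel_right, mul_div_cancel_left₀ _ hp1.ne'] at this
    refine this.congr_of_eventuallyEq ?_
    filter_upwards [eventually_gt_nhds h] with v hv
    rw [posPow_of_nonneg hv.le]

theorem intervalIntegrable_posPow_affine {p : ℝ} (hp : -1 < p) (hp0 : p ≠ 0) (s c x y : ℝ)
    (hc : c ≠ 0) : IntervalIntegrable (fun u => posPow p (s + c * u)) volume x y := by
  have h := (intervalIntegrable_posPow hp hp0 (s + c * x) (s + c * y)).comp_add_left s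
  have h2 := h.comp_mul_left (c := c)
  simpa [hc] using h2

theorem integral_posPow_affine {p : ℝ} (hp : -1 < p) (hp0 : p ≠ 0) {c : ℝ} (hc : c ≠ 0)
    (s N : ℝ) : ∫ u in (-N)..N, posPow p (s + c * u) =
      (posPow (p + 1) (s + c * N) - posPow (p + 1) (s - c * N)) / (c * (p + 1)) := by
  rw [intervalIntegral.integral_comp_add_mul _ hc, integral_posPow hp hp0, smul_eq_mul,
    show s + c * -N = s - c * N by ring]
  have : p + 1 ≠ 0 := by linarith
  field_simp

/-- The iterated symmetric difference of `posPow q` with steps `c`. -/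
noncomputable def signSum (k : ℕ) (c : ℕ → ℝ) (q s : ℝ) : ℝ :=
  ∑ ε : Fin k → ℤˣ, (∏ i, ((ε i : ℤ) : ℝ)) *
    posPow q (s + ∑ i : Fin k, ((ε i : ℤ) : ℝ) * c i)

theorem signSum_succ (k : ℕ) (c : ℕ → ℝ) (q s : ℝ) :
    signSum (k + 1) c q s = ∑ ε : Fin k → ℤˣ, (∏ i, ((ε i : ℤ) : ℝ)) *
      (posPow q (s + (∑ i : Fin k, ((ε i : ℤ) : ℝ) * c i) + c k) -
        posPow q (s + (∑ i : Fin k, ((ε i : ℤ) : ℝ) * c i) - c k)) := by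
  unfold signSum
  rw [← Fintype.sum_equiv (Fin.snocEquiv fun _ : Fin (k + 1) => ℤˣ) _ _ (fun _ => rfl),
    Fintype.sum_prod_type, Finset.sum_comm]
  refine Finset.sum_congr rfl fun ε _ => ?_
  rw [UnitsInt.univ, Finset.sum_pair (by decide)]
  simp only [Fin.snocEquiv, Equiv.coe_fn_mk, Fin.prod_univ_castSucc, Fin.sum_univ_castSucc,
    Fin.snoc_castSucc, Fin.snoc_last, Fin.val_castSucc, Fin.val_last, Units.val_one, Units.val_neg,
    Int.cast_one, Int.cast_neg, ← add_assoc]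
  simp only [one_mul, mul_one, neg_mul, mul_neg, ← sub_eq_add_neg]
  ring

section

variable {a b N : ℝ}

theorem integrable_prod_sliceVol_mul_posPow (hb : 0 < b) (hN : 0 ≤ N) (hab : |a| ≤ b) (k : ℕ)
    {p : ℝ} (hp : -1 < p) (hp0 : p ≠ 0) {β : ℝ} (hβ : β ≠ 0) (s : ℝ) :
    Integrable (Function.uncurry fun u v =>
      sliceVol a b N k (b⁻¹ * v + -(b⁻¹ * a ^ (k + 1)) * u) * posPow p (s + β * v))
      ((volume.restrict (uIoc (-N) N)).prod volume) := by
  have hg := sliceVol_symmDecr (a := a) hb hN k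
  set R := (k + 2) * N * b ^ (k + 1) with hR
  have hR0 : 0 ≤ R := by positivity
  have h1 : Integrable ((Icc (-R) R).indicator fun v => posPow p (s + β * v)) := by
    rw [integrable_indicator_iff measurableSet_Icc, ← intervalIntegrable_iff_integrableOn_Icc_of_le
      (by linarith)]
    exact intervalIntegrable_posPow_affine hp hp0 s β _ _ hβ
  have h2 : Integrable (fun z : ℝ × ℝ => (1 : ℝ) *
      (Icc (-R) R).indicator (fun v => posPow p (s + β * v)) z.2)
      ((volume.restrict (uIoc (-N) N)).prod volume) := by
    refine Integrable.mul_prod (f := fun _ => (1 : ℝ)) ?_ h1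
    rw [uIoc_of_le (by linarith)]
    exact integrable_const _
  have h3 := h2.bdd_mul (c := (2 * (N / b)) ^ k)
    (f := fun z => sliceVol a b N k (b⁻¹ * z.2 + -(b⁻¹ * a ^ (k + 1)) * z.1))
    ((hg.measurable.comp (by fun_prop)).aestronglyMeasurable) (Filter.Eventually.of_forall fun z => by
      rw [Real.norm_eq_abs, abs_of_nonneg (hg.nonneg _)]
      exact sliceVol_le hb hN k _)
  refine h3.congr ?_
  have e : (volume.restrict (uIoc (-N) N)).prod (volume : Measure ℝ) =
      ((volume : Measure ℝ).prod volume).restrict (uIoc (-N) N ×ˢ univ) := by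
    rw [← Measure.prod_restrict, Measure.restrict_univ]
  rw [e]
  refine ae_restrict_of_forall_mem (measurableSet_uIoc.prod MeasurableSet.univ) ?_
  rintro ⟨u, v⟩ ⟨hu, -⟩
  rw [uIoc_of_le (by linarith)] at hu
  simp only [one_mul, Function.uncurry_apply_pair]
  by_cases hv : v ∈ Icc (-R) R
  · rw [indicator_of_mem hv]
  · rw [sliceVol_eq_zero hb hN hab, zero_mul, zero_mul]
    have hv' : R < |v| := by
      by_contra h
      exact hv (abs_le.1 (not_lt.1 h))
    have h4 : |a ^ (k + 1) * u| ≤ b ^ (k + 1) * N := by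
      rw [abs_mul, abs_pow]
      exact mul_le_mul (pow_le_pow_left₀ (abs_nonneg a) hab _) (abs_le.2 ⟨hu.1.le, hu.2⟩)
        (abs_nonneg u) (by positivity)
    have h5 : b⁻¹ * v + -(b⁻¹ * a ^ (k + 1)) * u = b⁻¹ * (v - a ^ (k + 1) * u) := by ring
    rw [h5, abs_mul, abs_inv, abs_of_pos hb, lt_inv_mul_iff₀ hb]
    have h6 := abs_sub_abs_le_abs_sub v (a ^ (k + 1) * u)
    calc b * ((k + 1) * N * b ^ k) = R - b ^ (k + 1) * N := by rw [hR]; ring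
      _ < _ := by linarith

theorem integral_sliceVol_mul_posPow (hb : 0 < b) (hN : 0 ≤ N) (hab : |a| ≤ b) (ha : a ≠ 0)
    {p : ℝ} (hp : -1 < p) (hp0 : p ≠ 0) (k : ℕ) {β : ℝ} (hβ : β ≠ 0) (s : ℝ) :
    ∫ v, sliceVol a b N k v * posPow p (s + β * v) =
      (∏ i ∈ Finset.range (k + 1), ((p + 1 + i) * (β * a ^ i * b ^ (k - i))))⁻¹ *
        signSum (k + 1) (fun j => β * a ^ j * b ^ (k - j) * N) (p + 1 + k) s := by
  induction k generalizing β s with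
  | zero =>
    have h1 : ∀ v, sliceVol a b N 0 v * posPow p (s + β * v) =
        (Icc (-N) N).indicator (fun v => posPow p (s + β * v)) v := fun v => by
      simp only [sliceVol, indicator, mem_Icc, ← abs_le]
      split_ifs <;> simp
    simp only [h1]
    rw [integral_indicator measurableSet_Icc, integral_Icc_eq_integral_Ioc,
      ← intervalIntegral.integral_of_le (by linarith), integral_posPow_affine hp hp0 hβ, signSum_succ]
    simp [div_eq_inv_mul, mul_comm β]
  | succ k ih =>
    have hβb : β * b ≠ 0 := mul_ne_zero hβ hb.ne'
    have h1 : ∀ v, sliceVol a b N (k + 1) v * posPow p (s + β * v) =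
        b⁻¹ * ∫ u in (-N)..N, sliceVol a b N k (b⁻¹ * v + -(b⁻¹ * a ^ (k + 1)) * u) *
          posPow p (s + β * v) := fun v => by
      rw [intervalIntegral.integral_mul_const, ← mul_assoc]
      rfl
    have h2 : ∀ u, (∫ v, sliceVol a b N k (b⁻¹ * v + -(b⁻¹ * a ^ (k + 1)) * u) *
        posPow p (s + β * v)) = b * ∫ v, sliceVol a b N k v *
          posPow p ((s + β * a ^ (k + 1) * u) + β * b * v) := fun u => by
      have e1 := integral_sub_right_eq_self (μ := (volume : Measure ℝ))
        (fun v => sliceVol a b N k (b⁻¹ * v) * posPow p (s + β * (v + a ^ (k + 1) * u)))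
        (a ^ (k + 1) * u)
      have e2 := Measure.integral_comp_mul_left (fun v => sliceVol a b N k v *
          posPow p ((s + β * a ^ (k + 1) * u) + β * b * v)) b⁻¹
      rw [inv_inv, abs_of_pos hb, smul_eq_mul] at e2
      rw [← e2]
      refine Eq.trans ?_ (e1.trans ?_)
      · congr 1; funext v; congr 2 <;> ring
      · congr 1; funext v; congr 2; field_simp; ring
    simp only [h1]
    rw [integral_const_mul, ← intervalIntegral_integral_swap
      (integrable_prod_sliceVol_mul_posPow hb hN hab k hp hp0 hβ s)]
    simp only [h2, ih hβb]
    have hc : β * a ^ (k + 1) ≠ 0 := mul_ne_zero hβ (pow_ne_zero _ ha)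
    have hq : -1 < p + 1 + k := by
      have : (0 : ℝ) ≤ k := Nat.cast_nonneg k
      linarith
    have hq0 : p + 1 + k ≠ 0 := by
      have : (0 : ℝ) ≤ k := Nat.cast_nonneg k
      linarith
    have hcoef : ∀ i ∈ Finset.range (k + 1),
        β * a ^ i * b ^ (k + 1 - i) = β * b * a ^ i * b ^ (k - i) := fun i hi => by
      have : k + 1 - i = k - i + 1 := by have := Finset.mem_range.1 hi; omega
      rw [this]; ring
    have h3 : (∫ u in (-N)..N, signSum (k + 1) (fun j => β * b * a ^ j * b ^ (k - j) * N)
        (p + 1 + k) (s + β * a ^ (k + 1) * u)) =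
        signSum (k + 2) (fun j => β * a ^ j * b ^ (k + 1 - j) * N) (p + 1 + (k + 1 : ℕ)) s /
          (β * a ^ (k + 1) * (p + 1 + (k + 1 : ℕ))) := by
      rw [signSum_succ, Finset.sum_div]
      unfold signSum
      have hint : ∀ ε : Fin (k + 1) → ℤˣ, ∀ u : ℝ,
          posPow (p + 1 + k) (s + β * a ^ (k + 1) * u +
            ∑ i : Fin (k + 1), ((ε i : ℤ) : ℝ) * (β * b * a ^ (i : ℕ) * b ^ (k - (i : ℕ)) * N)) =
          posPow (p + 1 + k) ((s + ∑ i : Fin (k + 1), ((ε i : ℤ) : ℝ) *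
            (β * b * a ^ (i : ℕ) * b ^ (k - (i : ℕ)) * N)) + β * a ^ (k + 1) * u) := fun ε u => by
        congr 1; ring
      simp only [hint]
      rw [intervalIntegral.integral_finsetSum fun ε _ =>
        (intervalIntegrable_posPow_affine hq hq0 _ _ _ _ hc).const_mul _]
      refine Finset.sum_congr rfl fun ε _ => ?_
      rw [intervalIntegral.integral_const_mul, integral_posPow_affine hq hq0 hc, mul_div_assoc]
      have e1 : p + 1 + (k : ℝ) + 1 = p + 1 + (k + 1 : ℕ) := by push_cast; ring
      have e2 : ∑ i : Fin (k + 1), ((ε i : ℤ) : ℝ) *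
            (β * b * a ^ (i : ℕ) * b ^ (k - (i : ℕ)) * N) = ∑ i : Fin (k + 1), ((ε i : ℤ) : ℝ) *
            (β * a ^ (i : ℕ) * b ^ (k + 1 - (i : ℕ)) * N) :=
        Finset.sum_congr rfl fun i _ => by rw [hcoef i (Finset.mem_range.2 i.2)]
      rw [e1, e2]
      simp
    rw [intervalIntegral.integral_const_mul, intervalIntegral.integral_const_mul, h3,
      Finset.prod_range_succ _ (k + 1)]
    have h4 : ∏ i ∈ Finset.range (k + 1), ((p + 1 + i) * (β * a ^ i * b ^ (k + 1 - i))) =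
        ∏ i ∈ Finset.range (k + 1), ((p + 1 + i) * (β * b * a ^ i * b ^ (k - i))) :=
      Finset.prod_congr rfl fun i hi => by rw [hcoef i hi]
    rw [h4, Nat.sub_self, pow_zero, mul_one, inv_mul_cancel_left₀ hb.ne', mul_inv]
    ring

theorem integral_sliceVol_sq (hb : 0 < b) (hN : 0 ≤ N) (hab : |a| ≤ b) (k : ℕ) {R : ℝ}
    (hR : 0 ≤ R) (hR2 : (k + 1) * N * b ^ k ≤ R ^ 2) :
    ∫ y in (-R)..R, sliceVol a b N k (y ^ 2) =
      ∫ v, sliceVol a b N k v * posPow (-1 / 2) v := by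
  have h1 : ∫ y in (-R)..R, sliceVol a b N k (y ^ 2) = ∫ y, sliceVol a b N k (|y| ^ 2) := by
    simp only [sq_abs]
    rw [intervalIntegral.integral_of_le (by linarith), ← integral_Icc_eq_integral_Ioc]
    refine setIntegral_eq_integral_of_forall_compl_eq_zero fun y hy => ?_
    refine sliceVol_eq_zero hb hN hab k _ (hR2.trans_lt ?_)
    rw [abs_pow, sq_lt_sq, abs_of_nonneg hR, abs_abs]
    by_contra h
    exact hy (abs_le.1 (not_lt.1 h))
  rw [h1, integral_comp_abs (f := fun y => sliceVol a b N k (y ^ 2)),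
    ← integral_comp_rpow_Ioi_of_pos (g := fun y => sliceVol a b N k (y ^ 2))
      (by norm_num : (0 : ℝ) < 1 / 2), ← integral_const_mul, posPow_eq_indicator (by norm_num)]
  have h2 : ∀ v, sliceVol a b N k v * (Ioi (0 : ℝ)).indicator (fun s => s ^ (-1 / 2 : ℝ)) v =
      (Ioi (0 : ℝ)).indicator (fun v => sliceVol a b N k v * v ^ (-1 / 2 : ℝ)) v := fun v => by
    simp only [indicator]
    split_ifs <;> simp
  simp only [h2]
  rw [integral_indicator measurableSet_Ioi]
  refine setIntegral_congr_fun measurableSet_Ioi fun v hv => ?_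
  have hv0 : (0 : ℝ) ≤ v := (mem_Ioi.1 hv).le
  simp only [smul_eq_mul]
  rw [← Real.sqrt_eq_rpow, Real.sq_sqrt hv0, show (1 / 2 - 1 : ℝ) = -1 / 2 by norm_num]
  ring

end

theorem gamma_eq_of_ne_zero {a b : ℤ} (ha : a ≠ 0) (hb : 0 < b) :
    gamma a b = 1 / (b : ℝ) ^ 3 * (1 / (3 * 5 * 7 * 9 * 11 * 13 * (|(a : ℝ)| / b) ^ 21) *
      signSum 7 (fun j => (|(a : ℝ)| / b) ^ j) (13 / 2) 0) := by
  have hbR : (0 : ℝ) < b := by exact_mod_cast hb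
  have haR : 0 < |(a : ℝ)| := abs_pos.2 (by exact_mod_cast ha)
  rw [gamma, if_neg hb.ne', phi, abs_of_pos hbR, if_neg (by positivity)]
  simp only [signSum, posPow, zero_add]

theorem signSum_mul {k : ℕ} {c : ℕ → ℝ} {q r : ℝ} (hr : 0 ≤ r) :
    signSum k (fun j => r * c j) q 0 = r ^ q * signSum k c q 0 := by
  unfold signSum
  rw [Finset.mul_sum]
  refine Finset.sum_congr rfl fun ε _ => ?_
  have : ∑ i : Fin k, ((ε i : ℤ) : ℝ) * (r * c i) = r * ∑ i : Fin k, ((ε i : ℤ) : ℝ) * c i := by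
    rw [Finset.mul_sum]
    exact Finset.sum_congr rfl fun i _ => by ring
  rw [this, zero_add, zero_add, posPow_mul hr]
  ring

theorem integral_sliceVol_sq_of_ne_zero {a b : ℤ} (ha : a ≠ 0) (hb : 0 < b) (hab : |a| ≤ b)
    {N : ℕ} (hN : 1 ≤ N) :
    ∫ v, sliceVol a b N 6 v * posPow (-1 / 2) v = (2 * (N : ℝ)) ^ 7 * (gamma a b / √(N : ℝ)) := by
  have hbR : (0 : ℝ) < b := by exact_mod_cast hb
  have haR : 0 < |(a : ℝ)| := abs_pos.2 (by exact_mod_cast ha)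
  have habR : |(a : ℝ)| ≤ b := by rw [← Int.cast_abs]; exact_mod_cast hab
  have hNR : (0 : ℝ) < N := by exact_mod_cast hN
  have h := integral_sliceVol_mul_posPow (a := |(a : ℝ)|) hbR hNR.le (by rwa [abs_abs]) haR.ne'
    (p := -1 / 2) (by norm_num) (by norm_num) 6 one_ne_zero 0
  simp only [sliceVol_abs, zero_add, one_mul] at h
  have e1 : (fun j : ℕ => |(a : ℝ)| ^ j * (b : ℝ) ^ (6 - j) * N) = fun j : ℕ =>
      if j ≤ 6 then N * (b : ℝ) ^ 6 * (|(a : ℝ)| / b) ^ j else |(a : ℝ)| ^ j * N := by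
    funext j
    split_ifs with hj
    · obtain ⟨i, hi⟩ := Nat.exists_eq_add_of_le hj
      rw [hi, Nat.add_sub_cancel_left, div_pow, pow_add]
      field_simp
    · rw [Nat.sub_eq_zero_of_le (by omega)]; simp
  have e2 : signSum 7 (fun j => |(a : ℝ)| ^ j * (b : ℝ) ^ (6 - j) * N) (13 / 2) 0 =
      (N * (b : ℝ) ^ 6) ^ (13 / 2 : ℝ) * signSum 7 (fun j => (|(a : ℝ)| / b) ^ j) (13 / 2) 0 := by
    rw [← signSum_mul (by positivity), e1]
    unfold signSum
    refine Finset.sum_congr rfl fun ε _ => ?_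
    congr 3
  have e3 : (N * (b : ℝ) ^ 6) ^ (13 / 2 : ℝ) = (N : ℝ) ^ 7 / √(N : ℝ) * (b : ℝ) ^ 39 := by
    rw [Real.mul_rpow hNR.le (by positivity)]
    congr 1
    · rw [show (13 / 2 : ℝ) = (7 : ℕ) - 1 / 2 by norm_num, Real.rpow_sub hNR, Real.rpow_natCast,
        Real.sqrt_eq_rpow]
    · rw [← Real.rpow_natCast, ← Real.rpow_mul hbR.le, ← Real.rpow_natCast]
      norm_num
  have e4 : (-1 / 2 + 1 + ((6 : ℕ) : ℝ) : ℝ) = 13 / 2 := by norm_num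
  rw [e4, e2, e3] at h
  rw [h, gamma_eq_of_ne_zero ha hb]
  have hs : √(N : ℝ) ≠ 0 := (Real.sqrt_pos.2 hNR).ne'
  generalize signSum 7 (fun j => (|(a : ℝ)| / b) ^ j) (13 / 2) 0 = S
  simp only [Finset.prod_range_succ, Finset.prod_range_zero]
  field_simp
  norm_num
  ring

theorem sliceVol_zero_one (N : ℝ) (k : ℕ) (s : ℝ) :
    sliceVol 0 1 N k s = (2 * N) ^ k * sliceVol 0 1 N 0 s := by
  induction k generalizing s with
  | zero => simp
  | succ k ih =>
    have h1 : sliceVol 0 1 N (k + 1) s = (1 : ℝ)⁻¹ * ∫ u in (-N)..N,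
      sliceVol 0 1 N k ((1 : ℝ)⁻¹ * s + -((1 : ℝ)⁻¹ * 0 ^ (k + 1)) * u) := rfl
    rw [h1]
    simp only [ih, inv_one, one_mul, ne_eq, Nat.succ_ne_zero, not_false_eq_true, zero_pow, neg_zero,
      zero_mul, add_zero, intervalIntegral.integral_const, smul_eq_mul]
    ring

theorem integral_sliceVol_eq_gamma {a b : ℤ} (h : IsCoprime a b) (hb : 0 < b) (hab : |a| ≤ b)
    {N : ℕ} (hN : 1 ≤ N) :
    ∫ y in (-(3 * √(N : ℝ) * (b : ℝ) ^ 3))..(3 * √(N : ℝ) * (b : ℝ) ^ 3),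
      sliceVol a b N 6 (y ^ 2) = (2 * (N : ℝ)) ^ 7 * (gamma a b / √(N : ℝ)) := by
  have hbR : (0 : ℝ) < b := by exact_mod_cast hb
  have habR : |(a : ℝ)| ≤ b := by rw [← Int.cast_abs]; exact_mod_cast hab
  have hNR : (0 : ℝ) < N := by exact_mod_cast hN
  have hsq : √(N : ℝ) ^ 2 = N := Real.sq_sqrt hNR.le
  rcases eq_or_ne a 0 with rfl | ha
  · have hb1 : b = 1 := by
      rw [isCoprime_zero_left] at h
      exact (Int.isUnit_iff.1 h).resolve_right (by omega)
    subst hb1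
    simp only [Int.cast_zero, Int.cast_one, one_pow, mul_one]
    simp only [sliceVol_zero_one _ 6]
    rw [intervalIntegral.integral_const_mul,
      integral_sliceVol_sq one_pos hNR.le (by simp) 0 (by positivity)
        (by simp only [mul_pow, hsq]; norm_num; linarith),
      ← integral_sliceVol_sq one_pos hNR.le (by simp) 0 (Real.sqrt_nonneg N)
        (by rw [hsq]; norm_num)]
    have h1 : ∫ y in (-√(N : ℝ))..√(N : ℝ), sliceVol 0 1 N 0 (y ^ 2) =
        ∫ y in (-√(N : ℝ))..√(N : ℝ), (1 : ℝ) := by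
      refine intervalIntegral.integral_congr fun y hy => ?_
      rw [uIcc_of_le (by linarith [Real.sqrt_nonneg (N : ℝ)])] at hy
      simp only [sliceVol]
      rw [if_pos]
      rw [abs_of_nonneg (sq_nonneg y), ← hsq]
      exact sq_le_sq' hy.1 hy.2
    have hs : √(N : ℝ) ≠ 0 := (Real.sqrt_pos.2 hNR).ne'
    rw [h1, intervalIntegral.integral_const]
    simp only [gamma, phi]
    norm_num
    field_simp
    rw [hsq]
    ring
  · rw [← integral_sliceVol_sq_of_ne_zero ha hb hab hN]
    refine integral_sliceVol_sq hbR hNR.le habR 6 (by positivity) ?_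
    rw [mul_pow, mul_pow, hsq]
    have : 0 ≤ (N : ℝ) * (b : ℝ) ^ 6 := by positivity
    norm_num
    nlinarith

theorem gamma_nonneg_and_le {a b : ℤ} (h : IsCoprime a b) (hb : 0 < b) (hab : |a| ≤ b) :
    0 ≤ gamma a b ∧ gamma a b ≤ 3 / (b : ℝ) ^ 3 := by
  have hbR : (0 : ℝ) < b := by exact_mod_cast hb
  have h1 := integral_sliceVol_eq_gamma h hb hab le_rfl
  simp only [Nat.cast_one, Real.sqrt_one, mul_one, div_one] at h1
  have hg := sliceVol_symmDecr (a := a) (N := 1) hbR zero_le_one 6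
  have h0 : -(3 * (b : ℝ) ^ 3) ≤ 3 * (b : ℝ) ^ 3 := by
    have : 0 < (b : ℝ) ^ 3 := by positivity
    linarith
  constructor
  · have h2 := intervalIntegral.integral_nonneg (μ := volume) h0 fun y _ => hg.nonneg (y ^ 2)
    rw [h1] at h2
    linarith
  · have h2 := intervalIntegral.integral_mono_on h0 (hg.comp_sq.varBound.intervalIntegrable _ _)
      (intervalIntegrable_const (c := (2 * (1 / (b : ℝ))) ^ 6)) fun y _ =>
        sliceVol_le hbR zero_le_one 6 (y ^ 2)
    rw [h1, intervalIntegral.integral_const, smul_eq_mul] at h2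
    have h3 : (3 * (b : ℝ) ^ 3 - -(3 * (b : ℝ) ^ 3)) * (2 * (1 / (b : ℝ))) ^ 6 =
        2 ^ 7 * (3 / (b : ℝ) ^ 3) := by
      field_simp
      norm_num
    rw [h3] at h2
    linarith

theorem gamma_swap (a b : ℤ) (h : IsCoprime a b) : gamma b a = gamma a b := by
  rcases eq_or_ne a 0 with rfl | ha
  · have hb := Int.isUnit_iff.1 (isCoprime_zero_left.1 h)
    rcases hb with rfl | rfl <;> simp [gamma, phi]
  rcases eq_or_ne b 0 with rfl | hb
  · have ha := Int.isUnit_iff.1 (isCoprime_zero_right.1 h)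
    rcases ha with rfl | rfl <;> simp [gamma, phi]
  have hbR : 0 < |(b : ℝ)| := abs_pos.2 (by exact_mod_cast hb)
  have haR : 0 < |(a : ℝ)| := abs_pos.2 (by exact_mod_cast ha)
  have key : ∀ t : ℝ, 0 < t → signSum 7 (fun j => (t⁻¹) ^ j) (13 / 2) 0 * t ^ 39 =
      signSum 7 (fun j => t ^ j) (13 / 2) 0 := fun t ht => by
    have e : t ^ 39 = (t ^ 6) ^ (13 / 2 : ℝ) := by
      rw [← Real.rpow_natCast t 6, ← Real.rpow_mul ht.le, ← Real.rpow_natCast]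
      norm_num
    rw [e, mul_comm, ← signSum_mul (by positivity)]
    unfold signSum
    refine Fintype.sum_equiv (Equiv.arrowCongr Fin.revPerm (Equiv.refl _)) _ _ fun ε => ?_
    simp only [Equiv.arrowCongr_apply, Equiv.coe_refl, Function.comp_apply, id_eq,
      Fin.revPerm_symm, Fin.revPerm_apply]
    congr 1
    · exact (Fintype.prod_equiv Fin.revPerm _ _ fun i => by simp)
    · congr 2
      refine Fintype.sum_equiv Fin.revPerm _ _ fun i => ?_
      simp only [Fin.revPerm_apply, Fin.rev_rev, Fin.val_rev]
      congr 1
      obtain ⟨j, hj⟩ := Nat.exists_eq_add_of_le (Nat.lt_succ_iff.1 i.2)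
      rw [hj, show 7 - ((i : ℕ) + 1) = j by omega, pow_add, inv_pow]
      field_simp
  have hk := key (|(a : ℝ)| / |(b : ℝ)|) (by positivity)
  rw [inv_div] at hk
  rw [gamma, gamma, if_neg ha, if_neg hb, phi, phi, if_neg (by positivity), if_neg (by positivity)]
  simp only [signSum, posPow, zero_add] at hk
  rw [← hk]
  generalize ∑ ε : Fin 7 → ℤˣ, (∏ i, ((ε i : ℤ) : ℝ)) *
      (max (∑ i : Fin 7, ((ε i : ℤ) : ℝ) * (|(b : ℝ)| / |(a : ℝ)|) ^ (i : ℕ)) 0) ^ (13 / 2 : ℝ) = S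
  field_simp

open Polynomial in
/-- The dehomogenized form `F(X, 1)` over `ℂ`. -/
noncomputable def dehom (f : Fin 7 → ℤ) : ℂ[X] := ∑ j : Fin 7, C (f j : ℂ) * X ^ (j : ℕ)

theorem formPoly_aeval (f : Fin 7 → ℤ) (v : Fin 2 → ℂ) :
    MvPolynomial.aeval v (formPoly f) =
      ∑ j : Fin 7, (f j : ℂ) * v 0 ^ (j : ℕ) * v 1 ^ (6 - (j : ℕ)) := by
  simp [formPoly, map_sum]

theorem eval_aeval (g : Fin 2 → Polynomial ℂ) (q : MvPolynomial (Fin 2) ℚ) (t : ℂ) :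
    (MvPolynomial.aeval g q).eval t = MvPolynomial.aeval (fun i => (g i).eval t) q := by
  have := MvPolynomial.comp_aeval_apply (f := g)
    ((Polynomial.aeval (R := ℂ) t).restrictScalars ℚ) q
  simpa [Polynomial.coe_aeval_eq_eval] using this

theorem exists_zero_of_not_isUnit {q : MvPolynomial (Fin 2) ℚ} (hq : ¬ IsUnit q) (hq0 : q ≠ 0) :
    ∃ v : Fin 2 → ℂ, v ≠ 0 ∧ MvPolynomial.aeval v q = 0 := by
  by_contra! hne
  have hconst : ∀ g : Polynomial ℂ, (∀ x, g.eval x ≠ 0) → ∀ x y, g.eval x = g.eval y := by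
    intro g hg x y
    have hd : g.degree = 0 := by
      by_contra hd
      obtain ⟨z, hz⟩ := IsAlgClosed.exists_root g hd
      exact hg z hz
    rw [Polynomial.eq_C_of_degree_eq_zero hd, Polynomial.eval_C, Polynomial.eval_C]
  have h0 : ∀ z : ℂ, z ≠ 0 → ∀ x y : ℂ,
      MvPolynomial.aeval ![x, z] q = MvPolynomial.aeval ![y, z] q := by
    intro z hz x y
    have e : ∀ x : ℂ, (MvPolynomial.aeval ![Polynomial.X, Polynomial.C z] q).eval x =
        MvPolynomial.aeval ![x, z] q := fun x => by
      rw [eval_aeval]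
      congr 2
      funext i
      fin_cases i <;> simp
    rw [← e x, ← e y]
    refine hconst _ (fun t => ?_) x y
    rw [e]
    exact hne _ fun h => hz (by simpa using congrFun h 1)
  have h1 : ∀ x : ℂ, x ≠ 0 → ∀ y z : ℂ,
      MvPolynomial.aeval ![x, y] q = MvPolynomial.aeval ![x, z] q := by
    intro x hx y z
    have e : ∀ y : ℂ, (MvPolynomial.aeval ![Polynomial.C x, Polynomial.X] q).eval y =
        MvPolynomial.aeval ![x, y] q := fun y => by
      rw [eval_aeval]
      congr 2
      funext i
      fin_cases i <;> simp
    rw [← e y, ← e z]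
    refine hconst _ (fun t => ?_) y z
    rw [e]
    exact hne _ fun h => hx (by simpa using congrFun h 0)
  set c : ℚ := MvPolynomial.eval ![1, 1] q with hc
  have h2 : ∀ v : Fin 2 → ℚ, v 0 ≠ 0 → v 1 ≠ 0 → MvPolynomial.eval v q = c := by
    intro v hv0 hv1
    have hcast : ∀ x y : ℚ, MvPolynomial.aeval ![(x : ℂ), (y : ℂ)] q =
        ((MvPolynomial.eval ![x, y] q : ℚ) : ℂ) := fun x y => by
      have h := MvPolynomial.aeval_algebraMap_apply ℂ ![x, y] q
      rw [MvPolynomial.aeval_eq_eval] at h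
      have e : ⇑(algebraMap ℚ ℂ) ∘ ![x, y] = ![(x : ℂ), (y : ℂ)] := by
        funext i
        fin_cases i <;> simp
      rw [e] at h
      exact h.trans (eq_ratCast _ _)
    have e : v = ![v 0, v 1] := by
      funext i
      fin_cases i <;> simp
    have h5 := h0 (v 1) (by exact_mod_cast hv1) (v 0) ((1 : ℚ) : ℂ)
    have h6 := h1 ((1 : ℚ) : ℂ) (by simp) (v 1) ((1 : ℚ) : ℂ)
    have h7 := h5.trans h6
    rw [hcast, hcast] at h7
    rw [e]
    exact_mod_cast h7
  have h3 : (q - MvPolynomial.C c) * (MvPolynomial.X 0 * MvPolynomial.X 1) = 0 := by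
    refine MvPolynomial.funext fun v => ?_
    by_cases h0 : v 0 = 0
    · simp [h0]
    by_cases h1 : v 1 = 0
    · simp [h1]
    simp [h2 v h0 h1]
  have h4 : q = MvPolynomial.C c := by
    rcases mul_eq_zero.1 h3 with h | h
    · exact sub_eq_zero.1 h
    · rcases mul_eq_zero.1 h with h | h <;> exact absurd h (MvPolynomial.X_ne_zero _)
  apply hq
  rw [h4] at hq0 ⊢
  refine (IsUnit.mk0 c ?_).map MvPolynomial.C
  rintro h
  exact hq0 (by rw [h, map_zero])

/-- A form with a repeated factor has a double root, possibly at infinity. -/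
theorem exists_double_root {f : Fin 7 → ℤ} (hf : ¬ IsGenusTwo f) (h6 : f 6 ≠ 0) :
    ∃ z : ℂ, (dehom f).eval z = 0 ∧ (Polynomial.derivative (dehom f)).eval z = 0 := by
  rw [IsGenusTwo, Squarefree] at hf
  push Not at hf
  obtain ⟨q, ⟨r, hr⟩, hq⟩ := hf
  have hval := formPoly_aeval f
  have hq0 : q ≠ 0 := by
    rintro rfl
    have h := hval ![1, 0]
    rw [hr] at h
    simp [Fin.sum_univ_succ] at h
    exact h6 (by exact_mod_cast h.symm)
  obtain ⟨v, hv, hv0⟩ := exists_zero_of_not_isUnit hq hq0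
  by_cases hz : v 1 = 0
  · exfalso
    have hx : v 0 ≠ 0 := fun hx => hv (by funext i; fin_cases i <;> simp [hx, hz])
    have h := hval v
    rw [hr, map_mul, map_mul, hv0, hz] at h
    simp [Fin.sum_univ_succ] at h
    exact h.elim h6 hx
  · set g : Fin 2 → Polynomial ℂ := ![Polynomial.C (v 1) * Polynomial.X, Polynomial.C (v 1)] with hg
    set Q := MvPolynomial.aeval g q with hQ
    have h1 : Polynomial.C (v 1 ^ 6) * dehom f = Q * Q * MvPolynomial.aeval g r := by
      rw [hQ, ← map_mul, ← map_mul, ← hr]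
      simp only [formPoly, dehom, map_sum, map_mul, map_pow, MvPolynomial.aeval_X,
        MvPolynomial.aeval_C, hg, Matrix.cons_val_zero, Matrix.cons_val_one, Finset.mul_sum]
      refine Finset.sum_congr rfl fun j _ => ?_
      obtain ⟨i, hi⟩ := Nat.exists_eq_add_of_le (Nat.lt_succ_iff.1 j.2)
      have e : (algebraMap ℚ (Polynomial ℂ)) (f j : ℚ) = Polynomial.C (f j : ℂ) := by simp
      rw [e, hi, Nat.add_sub_cancel_left]
      ring
    have h2 : Q.eval (v 0 / v 1) = 0 := by
      rw [hQ, eval_aeval, ← hv0]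
      congr 2
      funext i
      fin_cases i <;> simp [hg]
      field_simp
    have hz6 : v 1 ^ 6 ≠ 0 := pow_ne_zero _ hz
    refine ⟨v 0 / v 1, ?_, ?_⟩
    · have h3 := congrArg (Polynomial.eval (v 0 / v 1)) h1
      simpa [h2, hz] using h3
    · have h3 := congrArg (fun p => (Polynomial.derivative p).eval (v 0 / v 1)) h1
      simp only [Polynomial.derivative_C_mul] at h3
      simpa [h2, hz, Polynomial.derivative_mul] using h3

theorem isGenusTwo_rev {f : Fin 7 → ℤ} (hf : IsGenusTwo f) : IsGenusTwo (f ∘ Fin.rev) := by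
  have h : formPoly (f ∘ Fin.rev) =
      MvPolynomial.renameEquiv ℚ (Equiv.swap (0 : Fin 2) 1) (formPoly f) := by
    simp only [formPoly, map_sum, map_mul, map_pow, MvPolynomial.renameEquiv_apply,
      MvPolynomial.rename_C, MvPolynomial.rename_X, Equiv.swap_apply_left, Equiv.swap_apply_right]
    refine Fintype.sum_equiv Fin.revPerm _ _ fun j => ?_
    simp only [Function.comp_apply, Fin.revPerm_apply, Fin.val_rev]
    rw [show 6 - (7 - ((j : ℕ) + 1)) = j by omega, show 7 - ((j : ℕ) + 1) = 6 - j by omega]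
    ring
  rw [IsGenusTwo, h]
  intro q hq
  set e := MvPolynomial.renameEquiv ℚ (Equiv.swap (0 : Fin 2) 1)
  have h1 := hf (e.symm q) (by
    rw [← map_mul, ← e.symm_apply_apply (formPoly f)]
    exact map_dvd e.symm hq)
  simpa using h1.map e

theorem formEval_intCast (f : Fin 7 → ℤ) (a b : ℤ) :
    formEval f a b = (homEval a b 6 f : ℤ) := by
  simp [formEval, homEval]

theorem formEval_mul (f : Fin 7 → ℤ) (c x z : ℚ) :
    formEval f (c * x) (c * z) = c ^ 6 * formEval f x z := by
  rw [formEval, formEval, Finset.mul_sum]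
  refine Finset.sum_congr rfl fun j _ => ?_
  obtain ⟨i, hi⟩ := Nat.exists_eq_add_of_le (Nat.lt_succ_iff.1 j.2)
  rw [hi, Nat.add_sub_cancel_left]
  ring

theorem natCard_points (f : Fin 7 → ℤ) (a b : ℤ) (h : IsCoprime a b) :
    Nat.card {P : RatPoint f // P.xCoord = pt a b h} =
      Nat.card {y : ℤ // y ^ 2 = homEval a b 6 f} := by
  have hne : (a : ℚ) ≠ 0 ∨ (b : ℚ) ≠ 0 := by
    by_contra! h0
    have ha : a = 0 := by exact_mod_cast h0.1
    have hb : b = 0 := by exact_mod_cast h0.2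
    subst ha hb
    exact not_isCoprime_zero_zero h
  have hcone : ∀ y : {y : ℤ // y ^ 2 = homEval a b 6 f},
      ((a : ℚ), (y.1 : ℚ), (b : ℚ)) ≠ 0 ∧ (y.1 : ℚ) ^ 2 = formEval f a b := fun y => by
    refine ⟨fun h0 => ?_, ?_⟩
    · rw [Prod.ext_iff, Prod.ext_iff] at h0
      exact hne.elim (fun h => h h0.1) fun h => h h0.2.2
    · rw [formEval_intCast]
      exact_mod_cast y.2
  let F : {y : ℤ // y ^ 2 = homEval a b 6 f} → {P : RatPoint f // P.xCoord = pt a b h} :=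
    fun y => ⟨Quotient.mk (coneSetoid f) ⟨((a : ℚ), (y.1 : ℚ), (b : ℚ)), hcone y⟩, rfl⟩
  symm
  refine Nat.card_eq_of_bijective F ⟨fun y y' hyy => ?_, fun P => ?_⟩
  · obtain ⟨c, hc, hcy⟩ := Quotient.exact (Subtype.ext_iff.1 hyy)
    simp only [Prod.mk.injEq] at hcy
    have hc1 : c = 1 := by
      rcases hne with h0 | h0
      · exact mul_right_cancel₀ h0 (by rw [one_mul]; exact hcy.1.symm)
      · exact mul_right_cancel₀ h0 (by rw [one_mul]; exact hcy.2.2.symm)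
    simp only [hc1, one_pow, one_mul] at hcy
    exact Subtype.ext (by exact_mod_cast hcy.2.1.symm)
  · obtain ⟨P, hP⟩ := P
    induction P using Quotient.inductionOn with
    | h v =>
    obtain ⟨c, hc⟩ := (Projectivization.mk_eq_mk_iff' ℚ _ _ _ _).1 hP.symm
    have hx : c * v.1.1 = a := by simpa using congrFun hc 0
    have hz : c * v.1.2.2 = b := by simpa using congrFun hc 1
    have hc0 : c ≠ 0 := by
      rintro rfl
      rw [zero_mul] at hx hz
      exact hne.elim (fun h => h hx.symm) fun h => h hz.symm
    have hy : (c ^ 3 * v.1.2.1) ^ 2 = (homEval a b 6 f : ℤ) := by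
      rw [← formEval_intCast, ← hx, ← hz, formEval_mul, ← v.2.2]
      ring
    obtain ⟨y, hy'⟩ : ∃ y : ℤ, (y : ℚ) = c ^ 3 * v.1.2.1 := by
      have hint : IsIntegral ℤ (c ^ 3 * v.1.2.1) := by
        refine IsIntegral.of_pow (n := 2) (by norm_num) ?_
        rw [hy]
        exact isIntegral_algebraMap (R := ℤ) (A := ℚ)
      obtain ⟨y, hy'⟩ := IsIntegrallyClosed.isIntegral_iff.1 hint
      exact ⟨y, by simpa using hy'⟩
    refine ⟨⟨y, ?_⟩, Subtype.ext (Quotient.sound ⟨c⁻¹, inv_ne_zero hc0, ?_⟩)⟩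
    · rw [← hy'] at hy
      exact_mod_cast hy
    · refine Prod.ext ?_ (Prod.ext ?_ ?_)
      · simp only [← hx, inv_mul_cancel_left₀ hc0]
      · simp only [hy', inv_pow]
        rw [inv_mul_cancel_left₀ (pow_ne_zero 3 hc0)]
      · simp only [← hz, inv_mul_cancel_left₀ hc0]

theorem eval_dehom (f : Fin 7 → ℤ) (z : ℂ) : (dehom f).eval z =
    f 0 + f 1 * z + f 2 * z ^ 2 + f 3 * z ^ 3 + f 4 * z ^ 4 + f 5 * z ^ 5 + f 6 * z ^ 6 := by
  simp [dehom, Fin.sum_univ_seven]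

theorem eval_derivative_dehom (f : Fin 7 → ℤ) (z : ℂ) :
    (Polynomial.derivative (dehom f)).eval z = f 1 + 2 * f 2 * z + 3 * f 3 * z ^ 2 +
      4 * f 4 * z ^ 3 + 5 * f 5 * z ^ 4 + 6 * f 6 * z ^ 5 := by
  simp [dehom, Fin.sum_univ_seven]
  ring

theorem natDegree_dehom_le (f : Fin 7 → ℤ) : (dehom f).natDegree ≤ 6 := by
  refine Polynomial.natDegree_sum_le_of_forall_le _ _ fun j _ => ?_
  exact (Polynomial.natDegree_C_mul_X_pow_le _ _).trans (Nat.lt_succ_iff.1 j.2)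

theorem natDegree_derivative_dehom_le (f : Fin 7 → ℤ) :
    (Polynomial.derivative (dehom f)).natDegree ≤ 5 :=
  (Polynomial.natDegree_derivative_le _).trans (by have := natDegree_dehom_le f; omega)

/-- Forms that differ only in their two lowest coefficients and have a double root among the zeros
of a fixed polynomial of degree at most `6`. -/
theorem card_le_six_of_double_root {T : Finset (Fin 7 → ℤ)} {W : Polynomial ℂ} (hW : W ≠ 0)
    (hdeg : W.natDegree ≤ 6)
    (hT : ∀ f ∈ T, ∃ z : ℂ, (dehom f).eval z = 0 ∧
      (Polynomial.derivative (dehom f)).eval z = 0 ∧ W.eval z = 0)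
    (htail : ∀ f ∈ T, ∀ g ∈ T, ∀ j : Fin 7, 2 ≤ (j : ℕ) → f j = g j) : T.card ≤ 6 := by
  classical
  choose! z hz1 hz2 hz3 using hT
  refine (Finset.card_le_card_of_injOn z (t := W.roots.toFinset) (fun f hf => ?_) ?_).trans
    ((Multiset.toFinset_card_le _).trans ((Polynomial.card_roots' W).trans hdeg))
  · rw [Finset.mem_coe, Multiset.mem_toFinset, Polynomial.mem_roots hW]
    exact hz3 f hf
  · intro f hf g hg hfg
    have ht := htail f hf g hg
    have a1 := hz1 f hf
    have a2 := hz2 f hf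
    have b1 := hz1 g hg
    have b2 := hz2 g hg
    rw [← hfg] at b1 b2
    rw [eval_dehom] at a1 b1
    rw [eval_derivative_dehom] at a2 b2
    rw [← ht 2 (by simp), ← ht 3 (by simp), ← ht 4 (by simp), ← ht 5 (by simp),
      ← ht 6 (by simp)] at b1 b2
    have h1 : (f 1 : ℂ) = g 1 := by linear_combination a2 - b2
    have h0 : (f 0 : ℂ) = g 0 := by linear_combination a1 - b1 - z f * h1
    funext j
    by_cases hj : 2 ≤ (j : ℕ)
    · exact ht j hj
    · have hj' : j = 0 ∨ j = 1 := by omega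
      rcases hj' with rfl | rfl
      · exact_mod_cast h0
      · exact_mod_cast h1

theorem card_box (k N : ℕ) : (box k N).card = (2 * N + 1) ^ k := by
  rw [box, Fintype.card_piFinset_const, Int.card_Icc]
  congr 1
  omega

theorem init_mem_box {k N : ℕ} {f : Fin (k + 1) → ℤ} (hf : f ∈ box (k + 1) N) :
    Fin.init f ∈ box k N := mem_box.2 fun _ => mem_box.1 hf _

theorem tail_mem_box {k N : ℕ} {f : Fin (k + 1) → ℤ} (hf : f ∈ box (k + 1) N) :
    Fin.tail f ∈ box k N := mem_box.2 fun _ => mem_box.1 hf _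

open Classical in
theorem card_not_isGenusTwo_le (N : ℕ) :
    ((box 7 N).filter fun f => ¬ IsGenusTwo f).card ≤ 7 * (2 * N + 1) ^ 6 := by
  have h1 : (((box 7 N).filter fun f => ¬ IsGenusTwo f).filter fun f => f 6 = 0).card ≤
      (2 * N + 1) ^ 6 := by
    rw [← card_box]
    refine Finset.card_le_card_of_injOn (fun f => Fin.init f)
      (fun f hf => ?_) fun f hf g hg hfg => ?_
    · simp only [Finset.coe_filter, Finset.mem_filter, Set.mem_ofPred_eq] at hf
      exact init_mem_box hf.1.1
    · simp only [Finset.coe_filter, Finset.mem_filter, Set.mem_ofPred_eq] at hf hg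
      rw [← Fin.snoc_init_self f, ← Fin.snoc_init_self g]
      simp only at hfg
      rw [hfg]
      congr 1
      exact hf.2.trans hg.2.symm
  have h2 : (((box 7 N).filter fun f => ¬ IsGenusTwo f).filter fun f => ¬ f 6 = 0).card ≤
      6 * (2 * N + 1) ^ 6 := by
    rw [← card_box]
    refine Finset.card_le_mul_card_image_of_maps_to (f := fun f : Fin 7 → ℤ => Fin.tail f)
      (fun f hf => ?_) 6 fun g hg => ?_
    · simp only [Finset.mem_filter] at hf
      exact tail_mem_box hf.1.1
    · set T := (((box 7 N).filter fun f => ¬ IsGenusTwo f).filter fun f => ¬ f 6 = 0).filter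
        fun f : Fin 7 → ℤ => Fin.tail f = g with hT
      rcases T.eq_empty_or_nonempty with h0 | ⟨f₀, hf₀⟩
      · rw [h0]; simp
      have hmem : ∀ f ∈ T, ¬ IsGenusTwo f ∧ f 6 ≠ 0 ∧ Fin.tail f = g := fun f hf => by
        simp only [hT, Finset.mem_filter] at hf
        exact ⟨hf.1.1.2, hf.1.2, hf.2⟩
      have htail : ∀ f ∈ T, ∀ f' ∈ T, ∀ j : Fin 7, 1 ≤ (j : ℕ) → f j = f' j := by
        intro f hf f' hf' j hj
        obtain ⟨i, rfl⟩ := Fin.exists_succ_eq.2 (show j ≠ 0 by rintro rfl; simp at hj)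
        exact (congrFun (hmem f hf).2.2 i).trans (congrFun (hmem f' hf').2.2 i).symm
      have heval : ∀ f ∈ T, ∀ z, (Polynomial.derivative (dehom f)).eval z =
          (Polynomial.derivative (dehom f₀)).eval z := fun f hf z => by
        have ht := htail f hf f₀ hf₀
        rw [eval_derivative_dehom, eval_derivative_dehom, ht 1 (by simp), ht 2 (by simp),
          ht 3 (by simp), ht 4 (by simp), ht 5 (by simp), ht 6 (by simp)]
      refine card_le_six_of_double_root (W := Polynomial.derivative (dehom f₀)) ?_
        ((natDegree_derivative_dehom_le f₀).trans (by norm_num)) (fun f hf => ?_)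
        fun f hf f' hf' j hj => htail f hf f' hf' j (by omega)
      · intro h
        have h3 : (Polynomial.derivative (dehom f₀)).coeff 5 = 0 := by rw [h, Polynomial.coeff_zero]
        rw [Polynomial.coeff_derivative] at h3
        have h4 : (dehom f₀).coeff 6 = f₀ 6 := by
          rw [dehom, Polynomial.finsetSum_coeff]
          simp only [Polynomial.coeff_C_mul_X_pow]
          simp [Fin.sum_univ_seven]
        rw [h4] at h3
        rcases mul_eq_zero.1 h3 with h3 | h3
        · exact (hmem f₀ hf₀).2.1 (by exact_mod_cast h3)
        · norm_num at h3
      · obtain ⟨z, h3, h4⟩ := exists_double_root (hmem f hf).1 (hmem f hf).2.1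
        exact ⟨z, h3, h4, by rw [← heval f hf, h4]⟩
  rw [← Finset.card_filter_add_card_filter_not (fun f : Fin 7 → ℤ => f 6 = 0)]
  omega

open Classical in
/-- The number of forms with a repeated factor taking the value `m ≠ 0` at `(a, b)`. -/
theorem card_slice_not_isGenusTwo_le : ∃ C : ℝ, 0 ≤ C ∧ ∀ (a b : ℤ), IsCoprime a b → 0 < b →
    ∀ (N : ℕ) (m : ℤ), m ≠ 0 →
    (((box 7 N).filter fun f => ¬ IsGenusTwo f ∧ homEval a b 6 f = m).card : ℝ) ≤
      C * ((N : ℝ) / b + 1) ^ 5 := by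
  obtain ⟨C, hC, hC5⟩ := sliceCard_le 5
  refine ⟨C + 192, by positivity, fun a b hab hb N m hm => ?_⟩
  have hbR : (0 : ℝ) < b := by exact_mod_cast hb
  have hbC : (b : ℂ) ≠ 0 := by exact_mod_cast hb.ne'
  set S := (box 7 N).filter fun f => ¬ IsGenusTwo f ∧ homEval a b 6 f = m with hS
  have h1 : (S.filter fun f => f 6 = 0).card ≤ sliceCard a b N 5 (m / b) := by
    unfold sliceCard
    refine Finset.card_le_card_of_injOn (fun f => Fin.init f)
      (fun f hf => ?_) fun f hf g hg hfg => ?_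
    · simp only [hS, Finset.coe_filter, Finset.mem_filter, Set.mem_ofPred_eq] at hf ⊢
      refine ⟨init_mem_box hf.1.1, ?_⟩
      have h2 := hf.1.2.2
      rw [← Fin.snoc_init_self f, homEval_snoc, show f (Fin.last 6) = 0 from hf.2, zero_mul,
        add_zero] at h2
      rw [← h2, Int.mul_ediv_cancel_left _ hb.ne']
    · simp only [hS, Finset.coe_filter, Finset.mem_filter, Set.mem_ofPred_eq] at hf hg
      rw [← Fin.snoc_init_self f, ← Fin.snoc_init_self g]
      simp only at hfg
      rw [hfg]
      congr 1
      exact hf.2.trans hg.2.symm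
  have h2 : (S.filter fun f => ¬ f 6 = 0).card ≤ 6 * ((box 5 N).filter fun g => b ^ 5 ∣
      m - ∑ j : Fin 5, g j * a ^ (2 + (j : ℕ)) * b ^ (5 - 1 - (j : ℕ))).card := by
    refine Finset.card_le_mul_card_image_of_maps_to
      (f := fun f : Fin 7 → ℤ => Fin.tail (Fin.tail f)) (fun f hf => ?_) 6 fun g hg => ?_
    · simp only [hS, Finset.mem_filter] at hf ⊢
      refine ⟨tail_mem_box (tail_mem_box hf.1.1), f 0 * b + f 1 * a, ?_⟩
      rw [← hf.1.2.2]
      simp [homEval, Fin.sum_univ_succ, Fin.tail]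
      ring
    · set T := (S.filter fun f => ¬ f 6 = 0).filter
        fun f : Fin 7 → ℤ => Fin.tail (Fin.tail f) = g with hT
      rcases T.eq_empty_or_nonempty with h0 | ⟨f₀, hf₀⟩
      · rw [h0]; simp
      have hmem : ∀ f ∈ T, ¬ IsGenusTwo f ∧ f 6 ≠ 0 ∧ Fin.tail (Fin.tail f) = g ∧
          homEval a b 6 f = m := fun f hf => by
        simp only [hT, hS, Finset.mem_filter] at hf
        exact ⟨hf.1.1.2.1, hf.1.2, hf.2, hf.1.1.2.2⟩
      have htail : ∀ f ∈ T, ∀ f' ∈ T, ∀ j : Fin 7, 2 ≤ (j : ℕ) → f j = f' j := by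
        intro f hf f' hf' j hj
        obtain ⟨i, rfl⟩ := Fin.exists_succ_eq.2 (show j ≠ 0 by rintro rfl; simp at hj)
        obtain ⟨l, rfl⟩ := Fin.exists_succ_eq.2 (show i ≠ 0 by rintro rfl; simp at hj)
        exact (congrFun (hmem f hf).2.2.1 l).trans (congrFun (hmem f' hf').2.2.1 l).symm
      set W : Polynomial ℂ := Polynomial.derivative (dehom f₀) *
        (Polynomial.C (b : ℂ) * Polynomial.X - Polynomial.C (a : ℂ)) -
          Polynomial.C (b : ℂ) * dehom f₀ with hW
      have hWz : ∀ z, W.eval z = (Polynomial.derivative (dehom f₀)).eval z * (b * z - a) -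
          b * (dehom f₀).eval z := fun z => by simp [hW]
      have hhom : ∀ f, (homEval a b 6 f : ℂ) = f 0 * b ^ 6 + f 1 * a * b ^ 5 +
          f 2 * a ^ 2 * b ^ 4 + f 3 * a ^ 3 * b ^ 3 + f 4 * a ^ 4 * b ^ 2 + f 5 * a ^ 5 * b +
          f 6 * a ^ 6 := fun f => by
        simp [homEval, Fin.sum_univ_seven]
      refine card_le_six_of_double_root (W := W) ?_ ?_ (fun f hf => ?_) htail
      · intro h
        have h3 := hWz (a / b)
        rw [h, Polynomial.eval_zero, mul_div_cancel₀ _ hbC, sub_self, mul_zero, zero_sub] at h3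
        have h4 : (dehom f₀).eval ((a : ℂ) / b) = 0 := by
          have := neg_eq_zero.1 h3.symm
          exact (mul_eq_zero.1 this).resolve_left hbC
        rw [eval_dehom] at h4
        have h5 := hhom f₀
        rw [(hmem f₀ hf₀).2.2.2] at h5
        have h6 : (m : ℂ) = 0 := by
          rw [h5]
          have := congrArg (fun t => t * (b : ℂ) ^ 6) h4
          simp only [zero_mul] at this
          rw [← this]
          field_simp
        exact hm (by exact_mod_cast h6)
      · refine (Polynomial.natDegree_sub_le_of_le ?_ ?_ : W.natDegree ≤ max 6 6)
        · refine (Polynomial.natDegree_mul_le_of_le (natDegree_derivative_dehom_le f₀)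
            (?_ : _ ≤ 1))
          compute_degree
        · exact (Polynomial.natDegree_C_mul_le _ _).trans (natDegree_dehom_le f₀)
      · obtain ⟨z, h3, h4⟩ := exists_double_root (hmem f hf).1 (hmem f hf).2.1
        refine ⟨z, h3, h4, ?_⟩
        have ht := htail f hf f₀ hf₀
        have e1 := hhom f
        have e2 := hhom f₀
        rw [(hmem f hf).2.2.2] at e1
        rw [(hmem f₀ hf₀).2.2.2] at e2
        rw [← ht 2 (by simp), ← ht 3 (by simp), ← ht 4 (by simp), ← ht 5 (by simp),
          ← ht 6 (by simp)] at e2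
        have e3 : (f 0 : ℂ) * b + f 1 * a = f₀ 0 * b + f₀ 1 * a :=
          mul_right_cancel₀ (pow_ne_zero 5 hbC) (by linear_combination e2 - e1)
        rw [hWz, eval_dehom, eval_derivative_dehom]
        rw [eval_dehom] at h3
        rw [eval_derivative_dehom] at h4
        rw [← ht 2 (by simp), ← ht 3 (by simp), ← ht 4 (by simp), ← ht 5 (by simp),
          ← ht 6 (by simp)]
        linear_combination h4 * (b * z - a) - b * h3 + e3
  have h3 := card_filter_dvd_le a b hab hb N 2 5 m
  have h4 := hC5 a b hab hb N (m / b)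
  have hx : (0 : ℝ) ≤ (N : ℝ) / b := by positivity
  have h5 : (2 * ((N : ℝ) / b) + 1) ^ 5 ≤ 32 * ((N : ℝ) / b + 1) ^ 5 := by
    calc _ ≤ (2 * ((N : ℝ) / b + 1)) ^ 5 := pow_le_pow_left₀ (by positivity) (by linarith) 5
      _ = _ := by rw [mul_pow]; norm_num
  rw [← Finset.card_filter_add_card_filter_not (fun f : Fin 7 → ℤ => f 6 = 0), Nat.cast_add]
  have h1' : ((S.filter fun f => f 6 = 0).card : ℝ) ≤ sliceCard a b N 5 (m / b) := by
    exact_mod_cast h1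
  have h2' : ((S.filter fun f => ¬ f 6 = 0).card : ℝ) ≤ 6 * (((box 5 N).filter fun g => b ^ 5 ∣
      m - ∑ j : Fin 5, g j * a ^ (2 + (j : ℕ)) * b ^ (5 - 1 - (j : ℕ))).card : ℝ) := by
    exact_mod_cast h2
  rw [add_mul]
  linarith

theorem le_errBound {b : ℤ} (hb : 0 < b) {N : ℕ} (hN : 1 ≤ N) :
    ((N : ℝ) / b + 1) ^ 6 ≤ 128 * errBound b N := by
  have hbR : (0 : ℝ) < b := by exact_mod_cast hb
  have h1 := one_le_sqrt_mul hb hN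
  have hx : (0 : ℝ) ≤ (N : ℝ) / b := by positivity
  unfold errBound
  set x := (N : ℝ) / b
  set r := √(N : ℝ) * (b : ℝ) ^ 3
  have h2 : 1 ≤ r * (x ^ 5 + 1) :=
    one_le_mul_of_one_le_of_one_le h1 (by have := pow_nonneg hx 5; linarith)
  have h3 : 0 ≤ x ^ 6 := by positivity
  rcases le_total x 1 with h | h
  · calc (x + 1) ^ 6 ≤ 2 ^ 6 := pow_le_pow_left₀ (by linarith) (by linarith) 6
      _ ≤ _ := by linarith
  · calc (x + 1) ^ 6 ≤ (2 * x) ^ 6 := pow_le_pow_left₀ (by linarith) (by linarith) 6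
      _ ≤ _ := by rw [mul_pow]; linarith

theorem mem_yRange {a b : ℤ} (hb : 0 < b) (hab : |a| ≤ b) {N : ℕ} {f : Fin 7 → ℤ}
    (hf : f ∈ box 7 N) {y : ℤ} (hy : y ^ 2 = homEval a b 6 f) : y ∈ yRange b N := by
  have hbR : (0 : ℝ) < b := by exact_mod_cast hb
  have h1 : |homEval a b 6 f| ≤ 7 * (N * b ^ 6) := by
    calc |homEval a b 6 f| ≤ ∑ j : Fin 7, |f j * a ^ (j : ℕ) * b ^ (6 - (j : ℕ))| :=
          Finset.abs_sum_le_sum_abs _ _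
      _ ≤ ∑ j : Fin 7, (N * b ^ 6 : ℤ) := by
          refine Finset.sum_le_sum fun j _ => ?_
          obtain ⟨i, hi⟩ := Nat.exists_eq_add_of_le (Nat.lt_succ_iff.1 j.2)
          rw [hi, Nat.add_sub_cancel_left, pow_add, abs_mul, abs_mul, abs_pow, abs_pow,
            abs_of_pos hb, mul_assoc]
          have h2 : |f j| ≤ N := abs_le.2 (mem_box.1 hf j)
          have h3 : |a| ^ (j : ℕ) ≤ b ^ (j : ℕ) := pow_le_pow_left₀ (abs_nonneg a) hab _
          gcongr
      _ = _ := by simp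
  have h2 : (y : ℝ) ^ 2 ≤ (3 * √(N : ℝ) * (b : ℝ) ^ 3) ^ 2 := by
    rw [mul_pow, mul_pow, Real.sq_sqrt (Nat.cast_nonneg N)]
    have h3 : (y : ℝ) ^ 2 ≤ 7 * (N * (b : ℝ) ^ 6) := by
      rw [← hy] at h1
      exact_mod_cast (le_abs_self _).trans h1
    have : 0 ≤ (N : ℝ) * (b : ℝ) ^ 6 := by positivity
    nlinarith
  have h3 := abs_le_of_sq_le_sq' h2 (by positivity)
  rw [yRange, Finset.mem_Icc, Int.ceil_le, Int.le_floor]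
  exact h3

open Classical in
theorem sum_natCard_eq {a b : ℤ} (hb : 0 < b) (hab : |a| ≤ b) (N : ℕ) :
    ∑ f ∈ curves N, Nat.card {y : ℤ // y ^ 2 = homEval a b 6 f} =
      ∑ y ∈ yRange b N, ((box 7 N).filter fun f => IsGenusTwo f ∧ homEval a b 6 f = y ^ 2).card := by
  have h1 : ∀ f ∈ curves N, Nat.card {y : ℤ // y ^ 2 = homEval a b 6 f} =
      ((yRange b N).filter fun y => y ^ 2 = homEval a b 6 f).card := fun f hf => by
    rw [← Nat.subtype_card]
    intro y
    rw [Finset.mem_filter]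
    exact ⟨fun h => h.2, fun h => ⟨mem_yRange hb hab (Finset.mem_filter.1 hf).1 h, h⟩⟩
  rw [Finset.sum_congr rfl h1]
  simp only [Finset.card_filter]
  rw [Finset.sum_comm]
  refine Finset.sum_congr rfl fun y _ => ?_
  rw [curves, Finset.sum_filter]
  refine Finset.sum_congr rfl fun f _ => ?_
  by_cases hf : IsGenusTwo f <;> simp [hf, eq_comm]

open Classical in
/-- The number of points with given `x`-coordinate, up to the claimed error. -/
theorem abs_sum_natCard_sub_le : ∃ C : ℝ, 0 ≤ C ∧ ∀ (a b : ℤ), IsCoprime a b → 0 < b → |a| ≤ b →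
    ∀ N : ℕ, 1 ≤ N → |∑ f ∈ curves N, (Nat.card {y : ℤ // y ^ 2 = homEval a b 6 f} : ℝ) -
      (2 * (N : ℝ)) ^ 7 * (gamma a b / √(N : ℝ))| ≤ C * errBound b N := by
  obtain ⟨C₁, hC₁, h₁⟩ := abs_sum_sliceCard_sub_integral_le
  obtain ⟨C₂, hC₂, h₂⟩ := card_slice_not_isGenusTwo_le
  obtain ⟨C₃, hC₃, h₃⟩ := sliceCard_le 6
  refine ⟨C₁ + 224 * C₂ + 128 * C₃, by positivity, fun a b h hb hab N hN => ?_⟩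
  have hbR : (0 : ℝ) < b := by exact_mod_cast hb
  have e1 := h₁ a b h hb N hN
  rw [integral_sliceVol_eq_gamma h hb hab hN] at e1
  set B : ℤ → ℝ := fun y =>
    ((box 7 N).filter fun f => ¬ IsGenusTwo f ∧ homEval a b 6 f = y ^ 2).card with hB
  have hBle : ∀ y, B y ≤ sliceCard a b N 6 (y ^ 2) := fun y => by
    simp only [hB, sliceCard]
    exact_mod_cast Finset.card_le_card (fun f hf => by
      rw [Finset.mem_filter] at hf ⊢
      exact ⟨hf.1, hf.2.2⟩)
  have e2 : ∑ f ∈ curves N, (Nat.card {y : ℤ // y ^ 2 = homEval a b 6 f} : ℝ) =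
      ∑ y ∈ yRange b N, (sliceCard a b N 6 (y ^ 2) : ℝ) - ∑ y ∈ yRange b N, B y := by
    rw [← Nat.cast_sum, sum_natCard_eq hb hab, Nat.cast_sum, ← Finset.sum_sub_distrib]
    refine Finset.sum_congr rfl fun y _ => ?_
    rw [eq_sub_iff_add_eq]
    simp only [hB, sliceCard]
    rw [← Finset.card_filter_add_card_filter_not (s := (box 7 N).filter fun f =>
      homEval a b 6 f = y ^ 2) IsGenusTwo, Finset.filter_filter, Finset.filter_filter]
    simp only [and_comm, Nat.cast_add]
  have e3 : ∑ y ∈ yRange b N, B y ≤ (224 * C₂ + 128 * C₃) * errBound b N := by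
    rw [← Finset.sum_filter_add_sum_filter_not (yRange b N) (fun y => y = 0), add_mul, add_comm]
    refine add_le_add ?_ ?_
    · refine sum_yRange_le hb hN hC₂ (Finset.filter_subset _ _) fun y hy => ?_
      exact h₂ a b h hb N (y ^ 2) (pow_ne_zero 2 (Finset.mem_filter.1 hy).2)
    · have h4 : ∑ y ∈ (yRange b N).filter (fun y => y = 0), B y ≤ B 0 := by
        rw [Finset.filter_eq']
        split_ifs
        · simp
        · simp [hB]
      refine h4.trans ((hBle 0).trans ((h₃ a b h hb N _).trans ?_))
      rw [mul_comm 128, mul_assoc]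
      exact mul_le_mul_of_nonneg_left (le_errBound hb hN) hC₃
  have e4 : 0 ≤ ∑ y ∈ yRange b N, B y := Finset.sum_nonneg fun y _ => by simp [hB]
  rw [e2]
  rw [abs_le] at e1 ⊢
  have e5 : (C₁ + 224 * C₂ + 128 * C₃) * errBound b N =
    C₁ * errBound b N + (224 * C₂ + 128 * C₃) * errBound b N := by ring
  rw [e5]
  constructor <;> linarith [e1.1, e1.2]

/-- The number of rational points with `x`-coordinate `(a : b)` on the curves in `𝒞_N`. -/
noncomputable def pointCount (a b : ℤ) (N : ℕ) : ℝ :=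
  ∑ f ∈ curves N, (Nat.card {y : ℤ // y ^ 2 = homEval a b 6 f} : ℝ)

theorem avgPoints_eq {a b : ℤ} (h : IsCoprime a b) (N : ℕ) :
    avgPoints (pt a b h) N = pointCount a b N / (curves N).card := by
  simp only [avgPoints, pointCount, natCard_points]

theorem pointCount_neg (a b : ℤ) (N : ℕ) : pointCount (-a) (-b) N = pointCount a b N := by
  unfold pointCount
  refine Finset.sum_congr rfl fun f _ => ?_
  have : homEval (-a) (-b) 6 f = homEval a b 6 f := by
    refine Finset.sum_congr rfl fun j _ => ?_
    obtain ⟨i, hi⟩ := Nat.exists_eq_add_of_le (Nat.lt_succ_iff.1 j.2)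
    have h1 : (-1 : ℤ) ^ (j : ℕ) * (-1) ^ i = 1 := by
      rw [← pow_add, ← hi]; norm_num
    rw [show 6 - (j : ℕ) = i by omega, neg_pow a, neg_pow b]
    linear_combination (f j * a ^ (j : ℕ) * b ^ i) * h1
  rw [this]

theorem rev_mem_curves {N : ℕ} {f : Fin 7 → ℤ} (hf : f ∈ curves N) : f ∘ Fin.rev ∈ curves N := by
  classical
  rw [curves, Finset.mem_filter, Fintype.mem_piFinset] at hf ⊢
  exact ⟨fun i => hf.1 _, isGenusTwo_rev hf.2⟩

theorem pointCount_swap (a b : ℤ) (N : ℕ) : pointCount b a N = pointCount a b N := by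
  unfold pointCount
  have hrev : ∀ f : Fin 7 → ℤ, (f ∘ Fin.rev) ∘ Fin.rev = f := fun f => by
    funext i; simp
  refine Finset.sum_bij' (fun f _ => f ∘ Fin.rev) (fun f _ => f ∘ Fin.rev)
    (fun f hf => rev_mem_curves hf) (fun f hf => rev_mem_curves hf) (fun f _ => hrev f)
    (fun f _ => hrev f) fun f _ => ?_
  have : homEval b a 6 f = homEval a b 6 (f ∘ Fin.rev) := by
    refine Fintype.sum_equiv Fin.revPerm _ _ fun j => ?_
    simp only [Function.comp_apply, Fin.revPerm_apply, Fin.val_rev, Fin.rev_rev]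
    rw [show 6 - (7 - ((j : ℕ) + 1)) = j by omega, show 7 - ((j : ℕ) + 1) = 6 - j by omega]
    ring
  rw [this]

theorem natCard_sq_eq_le (m : ℤ) : Nat.card {y : ℤ // y ^ 2 = m} ≤ 2 := by
  by_cases h : ∃ y : ℤ, y ^ 2 = m
  · obtain ⟨y, rfl⟩ := h
    have h1 : {z : ℤ | z ^ 2 = y ^ 2} ⊆ (({y, -y} : Finset ℤ) : Set ℤ) := fun z hz => by
      simpa using sq_eq_sq_iff_eq_or_eq_neg.1 hz
    have h2 := Set.ncard_le_ncard h1 (Finset.finite_toSet _)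
    rw [Set.ncard_coe_finset] at h2
    exact h2.trans Finset.card_le_two
  · have : IsEmpty {y : ℤ // y ^ 2 = m} := ⟨fun y => h ⟨y.1, y.2⟩⟩
    simp

theorem pointCount_div_mem (a b : ℤ) (N : ℕ) :
    0 ≤ pointCount a b N / (curves N).card ∧ pointCount a b N / (curves N).card ≤ 2 := by
  have h0 : 0 ≤ pointCount a b N := Finset.sum_nonneg fun _ _ => Nat.cast_nonneg _
  have h1 : pointCount a b N ≤ 2 * (curves N).card := by
    rw [mul_comm, ← nsmul_eq_mul]
    exact Finset.sum_le_card_nsmul _ _ _ fun f _ => by exact_mod_cast natCard_sq_eq_le _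
  exact ⟨by positivity, div_le_of_le_mul₀ (Nat.cast_nonneg _) (by norm_num) h1⟩

theorem abs_card_curves_sub_le {N : ℕ} (hN : 1 ≤ N) :
    |((curves N).card : ℝ) - (2 * (N : ℝ)) ^ 7| ≤ 5103 * (N : ℝ) ^ 6 := by
  classical
  have hNR : (1 : ℝ) ≤ N := by exact_mod_cast hN
  have h1 : (curves N).card + ((box 7 N).filter fun f => ¬ IsGenusTwo f).card =
      (2 * N + 1) ^ 7 := by
    rw [← card_box, ← Finset.card_filter_add_card_filter_not (s := box 7 N) IsGenusTwo]
    congr 2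
  have h2 := card_not_isGenusTwo_le N
  have h1' : ((curves N).card : ℝ) + ((box 7 N).filter fun f => ¬ IsGenusTwo f).card =
      (2 * (N : ℝ) + 1) ^ 7 := by exact_mod_cast h1
  have h2' : (((box 7 N).filter fun f => ¬ IsGenusTwo f).card : ℝ) ≤
      7 * (2 * (N : ℝ) + 1) ^ 6 := by
    exact_mod_cast h2
  have h3 : (2 * (N : ℝ) + 1) ^ 6 ≤ 729 * (N : ℝ) ^ 6 := by
    calc _ ≤ (3 * (N : ℝ)) ^ 6 := pow_le_pow_left₀ (by linarith) (by linarith) 6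
      _ = _ := by rw [mul_pow]; norm_num
  have h4 : (2 * (N : ℝ)) ^ 7 ≤ (2 * (N : ℝ) + 1) ^ 7 :=
    pow_le_pow_left₀ (by linarith) (by linarith) 7
  have h5 : (2 * (N : ℝ) + 1) ^ 7 - (2 * (N : ℝ)) ^ 7 ≤ 7 * (2 * (N : ℝ) + 1) ^ 6 := by
    have hp : (2 * (N : ℝ)) ≤ 2 * N + 1 := by linarith
    have hc : ∀ i : ℕ, i ≤ 6 → (2 * (N : ℝ)) ^ i * (2 * N + 1) ^ (6 - i) ≤ (2 * (N : ℝ) + 1) ^ 6 :=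
      fun i hi => by
        calc _ ≤ (2 * (N : ℝ) + 1) ^ i * (2 * N + 1) ^ (6 - i) := by gcongr
          _ = _ := by rw [← pow_add, Nat.add_sub_cancel' hi]
    have e : (2 * (N : ℝ) + 1) ^ 7 - (2 * (N : ℝ)) ^ 7 =
        ∑ i ∈ Finset.range 7, (2 * (N : ℝ)) ^ i * (2 * N + 1) ^ (6 - i) := by
      simp only [Finset.sum_range_succ, Finset.sum_range_zero]
      ring
    rw [e]
    refine (Finset.sum_le_card_nsmul _ _ _ fun i hi =>
      hc i (Nat.lt_succ_iff.1 (Finset.mem_range.1 hi))).trans ?_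
    simp
  rw [abs_le]
  constructor <;> linarith [Nat.cast_nonneg (α := ℝ) ((box 7 N).filter fun f => ¬ IsGenusTwo f).card]

theorem le_errBound_of_sqrt {b : ℤ} (hb : 0 < b) (N : ℕ) :
    √(N : ℝ) * (N : ℝ) ^ 5 / (b : ℝ) ^ 3 + √(N : ℝ) * (b : ℝ) ^ 3 ≤ errBound b N := by
  have hbR : (1 : ℝ) ≤ b := by exact_mod_cast hb
  have hb0 : (0 : ℝ) < b := by linarith
  have h1 : √(N : ℝ) * (N : ℝ) ^ 5 / (b : ℝ) ^ 3 ≤ √(N : ℝ) * (b : ℝ) ^ 3 * ((N : ℝ) / b) ^ 5 := by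
    have e : √(N : ℝ) * (b : ℝ) ^ 3 * ((N : ℝ) / b) ^ 5 = √(N : ℝ) * (N : ℝ) ^ 5 / (b : ℝ) ^ 2 := by
      rw [div_pow]; field_simp
    rw [e]
    exact div_le_div_of_nonneg_left (by positivity) (by positivity)
      (pow_le_pow_right₀ hbR (by norm_num))
  have h2 : 0 ≤ ((N : ℝ) / b) ^ 6 := by positivity
  unfold errBound
  linarith

theorem abs_pointCount_div_sub_le : ∃ C : ℝ, 0 ≤ C ∧ ∀ (a b : ℤ), IsCoprime a b → 0 < b →
    |a| ≤ b → ∀ N : ℕ, 1 ≤ N → |pointCount a b N / (curves N).card - gamma a b / √(N : ℝ)| ≤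
      C * (errBound b N / (N : ℝ) ^ 7) := by
  obtain ⟨C, hC, hmain⟩ := abs_sum_natCard_sub_le
  refine ⟨C + 5103 * 3 + 5 * 5103 ^ 7, by positivity, fun a b h hb hab N hN => ?_⟩
  have hbR : (1 : ℝ) ≤ b := by exact_mod_cast hb
  have hNR : (1 : ℝ) ≤ N := by exact_mod_cast hN
  have hN0 : (0 : ℝ) < N := by linarith
  have hs1 : 1 ≤ √(N : ℝ) := Real.one_le_sqrt.2 hNR
  have hs0 : 0 < √(N : ℝ) := by linarith
  obtain ⟨hg0, hg⟩ := gamma_nonneg_and_le h hb hab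
  have herr := le_errBound_of_sqrt hb N
  have hpos : 0 ≤ √(N : ℝ) * (N : ℝ) ^ 5 / (b : ℝ) ^ 3 := by positivity
  have hr := one_le_sqrt_mul hb hN
  have herr1 : 1 ≤ errBound b N := by linarith
  have hN7 : (0 : ℝ) < (N : ℝ) ^ 7 := by positivity
  rcases le_or_gt (5103 : ℝ) N with hbig | hsmall
  · have hcard := abs_card_curves_sub_le hN
    set c : ℝ := ((curves N).card : ℝ)
    have h1 : (N : ℝ) ^ 7 ≤ c := by
      have h2 : 5103 * (N : ℝ) ^ 6 ≤ (N : ℝ) ^ 7 := by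
        rw [pow_succ (N : ℝ) 6, mul_comm]
        exact mul_le_mul_of_nonneg_left hbig (by positivity)
      have h3 := (abs_le.1 hcard).1
      rw [mul_pow] at h3
      linarith
    have hc0 : 0 < c := by linarith
    have h2 := hmain a b h hb hab N hN
    rw [← pointCount] at h2
    have h3 : |((2 * (N : ℝ)) ^ 7 - c) * (gamma a b / √(N : ℝ))| ≤ 5103 * 3 * errBound b N := by
      rw [abs_mul, abs_sub_comm, abs_of_nonneg (by positivity : 0 ≤ gamma a b / √(N : ℝ))]
      calc _ ≤ 5103 * (N : ℝ) ^ 6 * (3 / (b : ℝ) ^ 3 / √(N : ℝ)) := by gcongr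
        _ = 5103 * 3 * (√(N : ℝ) * (N : ℝ) ^ 5 / (b : ℝ) ^ 3) := by
            have hsq : √(N : ℝ) ^ 2 = N := Real.sq_sqrt hN0.le
            field_simp
            rw [hsq]
        _ ≤ _ := by linarith
    have h4 : |pointCount a b N - c * (gamma a b / √(N : ℝ))| ≤
        (C + 5103 * 3) * errBound b N := by
      have := abs_add_le (pointCount a b N - (2 * (N : ℝ)) ^ 7 * (gamma a b / √(N : ℝ)))
        (((2 * (N : ℝ)) ^ 7 - c) * (gamma a b / √(N : ℝ)))
      rw [show pointCount a b N - (2 * (N : ℝ)) ^ 7 * (gamma a b / √(N : ℝ)) +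
        ((2 * (N : ℝ)) ^ 7 - c) * (gamma a b / √(N : ℝ)) =
        pointCount a b N - c * (gamma a b / √(N : ℝ)) by ring] at this
      linarith
    have h5 : pointCount a b N / c - gamma a b / √(N : ℝ) =
        (pointCount a b N - c * (gamma a b / √(N : ℝ))) / c := by
      field_simp
    rw [h5, abs_div, abs_of_pos hc0]
    calc _ ≤ (C + 5103 * 3) * errBound b N / (N : ℝ) ^ 7 := by gcongr
      _ = (C + 5103 * 3) * (errBound b N / (N : ℝ) ^ 7) := by ring
      _ ≤ _ := by
          have : 0 ≤ errBound b N / (N : ℝ) ^ 7 := by positivity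
          nlinarith
  · obtain ⟨h1, h2⟩ := pointCount_div_mem a b N
    have h3 : gamma a b ≤ 3 := hg.trans (div_le_self (by norm_num) (one_le_pow₀ hbR))
    have h4 : gamma a b / √(N : ℝ) ≤ 3 := (div_le_self hg0 hs1).trans h3
    have h5 : 0 ≤ gamma a b / √(N : ℝ) := by positivity
    have h6 : |pointCount a b N / (curves N).card - gamma a b / √(N : ℝ)| ≤ 5 := by
      rw [abs_le]; constructor <;> linarith
    have h7 : 1 ≤ 5103 ^ 7 * (errBound b N / (N : ℝ) ^ 7) := by
      rw [← mul_div_assoc, one_le_div hN7]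
      calc (N : ℝ) ^ 7 ≤ 5103 ^ 7 := pow_le_pow_left₀ hN0.le hsmall.le 7
        _ ≤ _ := le_mul_of_one_le_right (by positivity) herr1
    have h8 : 0 ≤ (C + 5103 * 3) * (errBound b N / (N : ℝ) ^ 7) := by positivity
    rw [add_mul]
    linarith

/-- The error term of the asymptotic formula, as a function of the height. -/
noncomputable def errTerm (H : ℝ) (N : ℕ) : ℝ :=
  H ^ (-6 : ℝ) * (N : ℝ) ^ (-1 : ℝ) + H ^ (-2 : ℝ) * (N : ℝ) ^ (-3 / 2 : ℝ) +
    H ^ (3 : ℝ) * (N : ℝ) ^ (-13 / 2 : ℝ)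

theorem errBound_div {b : ℤ} (hb : 0 < b) {N : ℕ} (hN : 1 ≤ N) :
    errBound b N / (N : ℝ) ^ 7 = errTerm b N := by
  have hbR : (0 : ℝ) < b := by exact_mod_cast hb
  have hN0 : (0 : ℝ) < N := by exact_mod_cast hN
  have hs : (N : ℝ) ^ (-3 / 2 : ℝ) = √(N : ℝ) / (N : ℝ) ^ 2 := by
    rw [Real.sqrt_eq_rpow, ← Real.rpow_natCast, ← Real.rpow_sub hN0]
    norm_num
  have hs' : (N : ℝ) ^ (-13 / 2 : ℝ) = √(N : ℝ) / (N : ℝ) ^ 7 := by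
    rw [Real.sqrt_eq_rpow, ← Real.rpow_natCast, ← Real.rpow_sub hN0]
    norm_num
  have e6 : (b : ℝ) ^ (-6 : ℝ) = ((b : ℝ) ^ 6)⁻¹ := by
    rw [Real.rpow_neg hbR.le]; norm_cast
  have e2 : (b : ℝ) ^ (-2 : ℝ) = ((b : ℝ) ^ 2)⁻¹ := by
    rw [Real.rpow_neg hbR.le]; norm_cast
  have e3 : (b : ℝ) ^ (3 : ℝ) = (b : ℝ) ^ 3 := by norm_cast
  rw [errTerm, errBound, hs, hs', e6, e2, e3, Real.rpow_neg_one, div_pow, div_pow]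
  field_simp
  ring

theorem height_comm (a b : ℤ) : height b a = height a b := max_comm _ _

theorem abs_avgPoints_sub_le : ∃ C : ℝ, 0 ≤ C ∧ ∀ N : ℕ, 1 ≤ N → ∀ (a b : ℤ) (h : IsCoprime a b),
    |avgPoints (pt a b h) N - gamma a b / √(N : ℝ)| ≤ C * errTerm (height a b) N := by
  obtain ⟨C, hC, hmain⟩ := abs_pointCount_div_sub_le
  refine ⟨C, hC, fun N hN a b h => ?_⟩
  rw [avgPoints_eq]
  have hpos : ∀ a b : ℤ, IsCoprime a b → 0 < b → |a| ≤ b →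
      |pointCount a b N / (curves N).card - gamma a b / √(N : ℝ)| ≤
        C * errTerm (height a b) N := fun a b h hb hab => by
    have hh : height a b = b := by
      have h1 : |(a : ℝ)| ≤ b := by rw [← Int.cast_abs]; exact_mod_cast hab
      rw [height, abs_of_pos (show (0 : ℝ) < b by exact_mod_cast hb), max_eq_right h1]
    rw [hh, ← errBound_div hb hN]
    exact hmain a b h hb hab N hN
  have hle : ∀ a b : ℤ, IsCoprime a b → |a| ≤ |b| →
      |pointCount a b N / (curves N).card - gamma a b / √(N : ℝ)| ≤
        C * errTerm (height a b) N := fun a b h hab => by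
    rcases lt_trichotomy b 0 with hb | rfl | hb
    · have h1 := hpos (-a) (-b) h.neg_neg (by omega) (by rwa [abs_neg, ← abs_of_neg hb])
      have hg : gamma (-a) (-b) = gamma a b := by simp [gamma]
      have hh : height (-a) (-b) = height a b := by simp [height]
      rwa [pointCount_neg, hg, hh] at h1
    · rw [abs_zero, abs_nonpos_iff] at hab
      subst hab
      exact absurd h not_isCoprime_zero_zero
    · exact hpos a b h hb (by rwa [abs_of_pos hb] at hab)
  rcases le_total |a| |b| with hab | hab
  · exact hle a b h hab
  · have h1 := hle b a h.symm hab
    rwa [pointCount_swap, gamma_swap a b h, height_comm] at h1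

theorem one_le_height {a b : ℤ} (h : IsCoprime a b) : 1 ≤ height a b := by
  by_contra! hlt
  rw [height, max_lt_iff, ← Int.cast_abs, ← Int.cast_abs] at hlt
  have ha : |a| < 1 := by exact_mod_cast hlt.1
  have hb : |b| < 1 := by exact_mod_cast hlt.2
  rw [Int.abs_lt_one_iff] at ha hb
  subst ha hb
  exact not_isCoprime_zero_zero h

theorem sqrt_mul_errTerm_le {H K ε : ℝ} (hH : 1 ≤ H) {N : ℕ} (hN : 1 ≤ N)
    (hHK : H ≤ K * (N : ℝ) ^ (2 - ε)) : √(N : ℝ) * errTerm H N ≤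
      (N : ℝ) ^ (-(1 / 2) : ℝ) + (N : ℝ) ^ (-1 : ℝ) + K ^ 3 * (N : ℝ) ^ (-(3 * ε)) := by
  have hN0 : (0 : ℝ) < N := by exact_mod_cast hN
  have e : ∀ x p : ℝ, √(N : ℝ) * (x * (N : ℝ) ^ p) = x * (N : ℝ) ^ (p + 1 / 2) := fun x p => by
    rw [Real.rpow_add hN0, Real.sqrt_eq_rpow]; ring
  rw [errTerm, mul_add, mul_add, e, e, e]
  have h6 : H ^ (-6 : ℝ) ≤ 1 := Real.rpow_le_one_of_one_le_of_nonpos hH (by norm_num)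
  have h2 : H ^ (-2 : ℝ) ≤ 1 := Real.rpow_le_one_of_one_le_of_nonpos hH (by norm_num)
  have h3 : H ^ (3 : ℝ) ≤ K ^ 3 * (N : ℝ) ^ (6 - 3 * ε) := by
    have h4 : H ^ (3 : ℝ) = H ^ 3 := by norm_cast
    rw [h4]
    refine (pow_le_pow_left₀ (by linarith) hHK 3).trans (le_of_eq ?_)
    rw [mul_pow, ← Real.rpow_natCast ((N : ℝ) ^ (2 - ε)), ← Real.rpow_mul hN0.le]
    congr 2
    push_cast
    ring
  refine add_le_add (add_le_add ?_ ?_) ?_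
  · rw [show (-1 + 1 / 2 : ℝ) = -(1 / 2) by norm_num]
    exact mul_le_of_le_one_left (by positivity) h6
  · rw [show (-3 / 2 + 1 / 2 : ℝ) = -1 by norm_num]
    exact mul_le_of_le_one_left (by positivity) h2
  · calc _ ≤ K ^ 3 * (N : ℝ) ^ (6 - 3 * ε) * (N : ℝ) ^ (-13 / 2 + 1 / 2 : ℝ) := by gcongr
      _ = _ := by
        rw [mul_assoc, ← Real.rpow_add hN0]
        congr 2
        ring

end GenusTwo

open Filter Topology in
theorem mainTheorem1 :
    (∃ C : ℝ, ∀ N : ℕ, 1 ≤ N → ∀ (a b : ℤ) (h : IsCoprime a b),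
      |GenusTwo.avgPoints (GenusTwo.pt a b h) N - GenusTwo.gamma a b / √(N : ℝ)| ≤
        C * ((GenusTwo.height a b) ^ (-6 : ℝ) * (N : ℝ) ^ (-1 : ℝ)
          + (GenusTwo.height a b) ^ (-2 : ℝ) * (N : ℝ) ^ (-3 / 2 : ℝ)
          + (GenusTwo.height a b) ^ (3 : ℝ) * (N : ℝ) ^ (-13 / 2 : ℝ))) ∧
    (∀ ε : ℝ, 0 < ε → ∀ K : ℝ, ∀ η : ℝ, 0 < η → ∃ N₀ : ℕ, ∀ N : ℕ, N₀ ≤ N →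
      ∀ (a b : ℤ) (h : IsCoprime a b), GenusTwo.height a b ≤ K * (N : ℝ) ^ (2 - ε) →
        |√(N : ℝ) * GenusTwo.avgPoints (GenusTwo.pt a b h) N - GenusTwo.gamma a b| < η) := by
  obtain ⟨C, hC, hmain⟩ := GenusTwo.abs_avgPoints_sub_le
  refine ⟨⟨C, hmain⟩, fun ε hε K η hη => ?_⟩
  have hlim : Tendsto (fun N : ℕ => C * ((N : ℝ) ^ (-(1 / 2) : ℝ) + (N : ℝ) ^ (-1 : ℝ) +
      K ^ 3 * (N : ℝ) ^ (-(3 * ε)))) atTop (𝓝 0) := by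
    have ht : ∀ p : ℝ, 0 < p → Tendsto (fun N : ℕ => (N : ℝ) ^ (-p)) atTop (𝓝 0) := fun p hp =>
      (tendsto_rpow_neg_atTop hp).comp tendsto_natCast_atTop_atTop
    simpa using (((ht (1 / 2) (by norm_num)).add (ht 1 one_pos)).add
      ((ht (3 * ε) (by positivity)).const_mul (K ^ 3))).const_mul C
  obtain ⟨N₁, hN₁⟩ := eventually_atTop.1 (hlim.eventually_lt_const hη)
  refine ⟨max N₁ 1, fun N hN a b h hH => ?_⟩
  have hN1 : 1 ≤ N := (le_max_right _ _).trans hN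
  have hs : 0 < √(N : ℝ) := Real.sqrt_pos.2 (by exact_mod_cast hN1)
  have e : √(N : ℝ) * GenusTwo.avgPoints (GenusTwo.pt a b h) N - GenusTwo.gamma a b =
      √(N : ℝ) * (GenusTwo.avgPoints (GenusTwo.pt a b h) N - GenusTwo.gamma a b / √(N : ℝ)) := by
    field_simp
  rw [e, abs_mul, abs_of_pos hs]
  calc _ ≤ √(N : ℝ) * (C * GenusTwo.errTerm (GenusTwo.height a b) N) :=
        mul_le_mul_of_nonneg_left (hmain N hN1 a b h) hs.le
    _ = C * (√(N : ℝ) * GenusTwo.errTerm (GenusTwo.height a b) N) := by ring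
    _ ≤ _ := mul_le_mul_of_nonneg_left
        (GenusTwo.sqrt_mul_errTerm_le (GenusTwo.one_le_height h) hN1 hH) hC
    _ < η := hN₁ N ((le_max_left _ _).trans hN)
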